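/- Let \(X\) be a Polish space (separable, completely metrizable). A function \(f:X\to\mathbb R\) is of Baire class 1 if it is the pointwise limit of a sequence of continuous functions. For \(A,B\subseteq X\) let \(\alpha_1(A,B)\) be the least \(\lambda<\omega_1\) for which there is a decreasing sequence \((F_\eta)_{\eta<\lambda}\) of closed sets with \(F_0=X\), with \(F_\theta=\bigcap_{\eta<\theta}F_\eta\) for limit \(\theta<\lambda\), and with \(\bigcap_{\eta<\lambda}F_\eta=\emptyset\) if \(\lambda\) is a limit, such that (with \(F_\eta=\emptyset\) for \(\eta\ge\lambda\)) \[A\subseteq\bigcup_{\eta<\lambda,\ \eta\text{ even}}F_\eta\setminus F_{\eta+1}\subseteq X\setminus B;\] if there is no such \(\lambda\), let \(\alpha_1(A,B)=\omega_1\). Put \(\alpha_1(f)=\sup\{\alpha_1(\{f\le p\},\{f\ge q\}):p<q,\ p,q\in\mathbb Q\}\), and let \(\mathscr B_1^\lambda(X)\) be the set of bounded Baire class 1 functions \(f\) on \(X\) with \(\alpha_1(f)\le\omega^\lambda\). For a sequence \((f_n)\) of real functions on \(X\), a closed set \(F\subseteq X\) and \(\varepsilon>0\), let \(D_{(f_n),\varepsilon}(F)\)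 be the set of \(x\in F\) with \[\inf_{U\ni x\text{ open}}\ \inf_{N\in\mathbb N}\ \sup\{|f_m(y)-f_n(y)|:m,n\ge N,\ y\in U\cap F\}\ge\varepsilon .\] Iterate \(D=D_{(f_n),\varepsilon}\) transfinitely by \(D^0(X)=X\), \(D^{\theta+1}(X)=D(D^\theta(X))\), and \(D^\theta(X)=\bigcap_{\eta<\theta}D^\eta(X)\) for limit \(\theta\). Let \(\mathrm{rk}(D)\) be the least \(\theta\) with \(D^\theta(X)=\emptyset\) (and \(\omega_1\) if there is none), and let \(\gamma((f_n))=\sup_{\varepsilon>0}\mathrm{rk}(D_{(f_n),\varepsilon})\) be the convergence rank. For a class \(\mathcal F\) of functions let \(\Phi(\mathcal F)\) be the set of bounded Baire class 1 functions \(f\) for which there are \(f_n\in\mathcal F\) with \(f_n\to f\) pointwise and \(\gamma((f_n))\le\omega\) (pseudouniform convergence). Define \(\Phi_0=\mathscr B_1^1(X)\) and, for \(0<\lambda<\omega_1\), \(\Phi_\lambda=\Phi\bigl(\bigcup_{\eta<\lambda}\Phi_\eta\bigr)\). **Theorem.** (1) For every Polish space \(X\) and every ordinal \(\lambda<\omega_1\)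 (zero, successor or limit), \(\Phi_\lambda=\mathscr B_1^{\lambda+1}(X)\). (2) In contrast, for every limit ordinal \(\lambda<\omega_1\) there are a Polish space \(X\) and a function \(f\in\mathscr B_1^\lambda(X)\) that is not the uniform limit of any sequence of functions from \(\bigcup_{\eta<\lambda}\mathscr B_1^\eta(X)\). -/

import Mathlib

open Set Filter Topology
open scoped ENNReal Ordinal

noncomputable section

/-- Baire class 1: pointwise limit of a sequence of continuous functions. -/
def IsBaireOne {X : Type*} [TopologicalSpace X] (f : X → ℝ) : Prop :=
  ∃ g : ℕ → X → ℝ, (∀ n, Continuous (g n)) ∧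
    ∀ x, Tendsto (fun n => g n x) atTop (𝓝 (f x))

/-- Boundedness of a real-valued function. -/
def IsBddFun {X : Type*} (f : X → ℝ) : Prop :=
  ∃ C : ℝ, ∀ x, |f x| ≤ C

/-- Even ordinals: `μ + 2n` with `μ` zero or a limit ordinal and `n` a natural number. -/
def IsEvenOrdinal (η : Ordinal.{0}) : Prop :=
  ∃ (μ : Ordinal.{0}) (n : ℕ), (μ = 0 ∨ Order.IsSuccLimit μ) ∧ η = μ + ((2 * n : ℕ) : Ordinal.{0})

/-- `(F η)_{η < len}` is a continuous decreasing transfinite sequence of closed sets with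
`F 0 = X` and with empty intersection if its length `len` is a limit ordinal;
it is extended by `F η = ∅` for `η ≥ len`. -/
structure IsClosedSeq {X : Type*} [TopologicalSpace X]
    (len : Ordinal.{0}) (F : Ordinal.{0} → Set X) : Prop where
  isClosed : ∀ η < len, IsClosed (F η)
  zero : F 0 = univ
  decreasing : ∀ η θ, η ≤ θ → θ < len → F θ ⊆ F η
  continuous : ∀ θ < len, Order.IsSuccLimit θ → F θ = ⋂ η ∈ Iio θ, F η
  inter_empty : Order.IsSuccLimit len → ⋂ η ∈ Iio len, F η = ∅
  eq_empty : ∀ η, len ≤ η → F η = ∅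

/-- `A` and `B` are separated by the transfinite difference of the sequence `(F η)_{η < len}`. -/
def SeparatedBy {X : Type*} (len : Ordinal.{0}) (F : Ordinal.{0} → Set X) (A B : Set X) : Prop :=
  A ⊆ (⋃ η ∈ {η : Ordinal.{0} | η < len ∧ IsEvenOrdinal η}, F η \ F (η + 1)) ∧
  (⋃ η ∈ {η : Ordinal.{0} | η < len ∧ IsEvenOrdinal η}, F η \ F (η + 1)) ⊆ Bᶜ

/-- The length of the shortest countable transfinite sequence of closed sets whose
transfinite difference separates `A` from `B`, and `ω₁` if there is none. -/
def sepRankSets {X : Type*} [TopologicalSpace X] (A B : Set X) : Ordinal.{0} :=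
  sInf (insert ω₁ {len : Ordinal.{0} | len < ω₁ ∧
    ∃ F : Ordinal.{0} → Set X, IsClosedSeq len F ∧ SeparatedBy len F A B})

/-- The (modified) separation rank `α₁(f)`, the supremum over rationals `p < q` of
the rank of the pair `{f ≤ p}`, `{f ≥ q}`. -/
def sepRank {X : Type*} [TopologicalSpace X] (f : X → ℝ) : Ordinal.{0} :=
  ⨆ r : {r : ℚ × ℚ // r.1 < r.2},
    sepRankSets {x | f x ≤ (r.1.1 : ℝ)} {x | (r.1.2 : ℝ) ≤ f x}

/-- The class of bounded Baire class 1 functions `f` on `X` with `α₁(f) ≤ ω ^ lam`. -/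
def BddBaireOne (X : Type*) [TopologicalSpace X] (lam : Ordinal.{0}) : Set (X → ℝ) :=
  {f | IsBaireOne f ∧ IsBddFun f ∧ sepRank f ≤ ω ^ lam}

/-- Iterated derivatives `D^θ(F)`, with intersections at limit stages. -/
def iterDeriv {X : Type*} (D : Set X → Set X) (F : Set X) (θ : Ordinal.{0}) : Set X :=
  Ordinal.limitRecOn θ F (fun _ S => D S) (fun θ _ S => ⋂ (η : Ordinal.{0}) (h : η < θ), S η h)

open Classical in
/-- The rank of a derivative: the least `θ` with `D^θ(X) = ∅`, and `ω₁` if there is none. -/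
def derivRank {X : Type*} (D : Set X → Set X) : Ordinal.{0} :=
  if ∃ θ : Ordinal.{0}, iterDeriv D univ θ = ∅ then
    sInf {θ : Ordinal.{0} | iterDeriv D univ θ = ∅}
  else ω₁

/-- The oscillation of the sequence `(f n)` at `x` restricted to `F`, as an extended real. -/
def seqOsc {X : Type*} [TopologicalSpace X] (f : ℕ → X → ℝ) (x : X) (F : Set X) : ℝ≥0∞ :=
  ⨅ (U : Set X) (_ : IsOpen U ∧ x ∈ U) (N : ℕ),
    ⨆ (m : ℕ) (n : ℕ) (y : X) (_ : N ≤ m ∧ N ≤ n ∧ y ∈ U ∩ F), ENNReal.ofReal |f m y - f n y|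

/-- The derivative associated with a sequence of functions and `ε`. -/
def seqDeriv {X : Type*} [TopologicalSpace X] (f : ℕ → X → ℝ) (ε : ℝ) (F : Set X) : Set X :=
  {x | x ∈ F ∧ ENNReal.ofReal ε ≤ seqOsc f x F}

/-- The convergence rank `γ((f n))` of a sequence of functions. -/
def convRank {X : Type*} [TopologicalSpace X] (f : ℕ → X → ℝ) : Ordinal.{0} :=
  ⨆ ε : {ε : ℝ // 0 < ε}, derivRank (seqDeriv f ε.1)

/-- The bounded Baire class 1 functions that are limits of pseudouniformly convergent
sequences of functions from `𝓕`. -/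
def pseudoLimits {X : Type*} [TopologicalSpace X] (𝓕 : Set (X → ℝ)) : Set (X → ℝ) :=
  {f | IsBaireOne f ∧ IsBddFun f ∧ ∃ g : ℕ → X → ℝ, (∀ n, g n ∈ 𝓕) ∧ convRank g ≤ ω ∧
    ∀ x, Tendsto (fun n => g n x) atTop (𝓝 (f x))}

/-- The families `Φ_lam`: `Φ_0` is the class of bounded Baire class 1 functions of rank at
most `ω`, and for `lam > 0`, `Φ_lam` consists of the pseudouniform limits from `⋃_{η < lam} Φ_η`. -/
def PhiFamily (X : Type*) [TopologicalSpace X] (lam : Ordinal.{0}) : Set (X → ℝ) :=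
  open Classical in
  if lam = 0 then BddBaireOne X 1
  else pseudoLimits (⋃ (η : Ordinal.{0}) (_h : η < lam), PhiFamily X η)
termination_by lam
decreasing_by exact _h

end

/-! Everything is phrased through upper semicontinuous ordinal ranks (`UscRank`). For bounded `f`
and `μ > 0`, `α₁(f) ≤ ω ^ μ` means that for each `ε` some rank `ρ < ω ^ μ` satisfies: every `x` has
a neighbourhood on which `ρ y ≤ ρ x`, and `|f y - f x| ≤ ε` whenever `ρ y = ρ x`. Sufficiency is
`sepRank_le_of_uscRank`; necessity is `exists_step_approx`, which merges finitely many ranks by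
natural sums, under which `ω ^ μ` is closed. Likewise `γ ≤ ω` means control of the Cauchy tails
along integer-valued ranks (`convRank_le_omega0_iff`).

If the terms have ranks below `ω ^ μ` and `κ` witnesses pseudouniform convergence, then `ω ^ μ * κ +
r` serves the limit, where `r` is a least rank of a locally good term
(`sepRank_le_of_pseudouniform`). Conversely, a function of rank `ω ^ (μ + 1)` is a telescoping
series of step functions. Its terms are truncated to points whose rank is early in its block of
length `ω ^ μ` and which stay away from the later ranks. Only the remainder modulo `ω ^ μ` then
matters, so the rank falls below some `ω ^ (η + 1)` with `η < μ`, while the block number witnesses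
pseudouniform convergence (`exists_pseudouniform_approx`). Induction on `lam` gives (1).

For (2), on a space of finite sets carrying a rank whose smaller values all occur near each point,
any rank deciding the parity of that rank dominates it. Hence no function uniformly close to the
parity indicator has smaller separation rank. -/

/-! ### Natural sums and powers of `ω`. -/

/-- The natural (Hessenberg) sum of two ordinals. -/
noncomputable def natAdd (a b : Ordinal.{0}) : Ordinal.{0} :=
  max (⨆ x : Iio a, Order.succ (natAdd x.1 b)) (⨆ y : Iio b, Order.succ (natAdd a y.1))
termination_by (a, b)
decreasing_by
  · exact Prod.Lex.left _ _ x.2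
  · exact Prod.Lex.right _ y.2

theorem natAdd_le_iff {a b c : Ordinal.{0}} :
    natAdd a b ≤ c ↔ (∀ x < a, natAdd x b < c) ∧ ∀ y < b, natAdd a y < c := by
  rw [natAdd, max_le_iff, Ordinal.iSup_le_iff, Ordinal.iSup_le_iff]
  simp only [Order.succ_le_iff, Subtype.forall, mem_Iio]

theorem natAdd_lt_left {a a' : Ordinal.{0}} (b : Ordinal.{0}) (h : a' < a) :
    natAdd a' b < natAdd a b :=
  (natAdd_le_iff.1 le_rfl).1 _ h

theorem natAdd_lt_right (a : Ordinal.{0}) {b b' : Ordinal.{0}} (h : b' < b) :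
    natAdd a b' < natAdd a b :=
  (natAdd_le_iff.1 le_rfl).2 _ h

theorem natAdd_le_natAdd {a a' b b' : Ordinal.{0}} (ha : a' ≤ a) (hb : b' ≤ b) :
    natAdd a' b' ≤ natAdd a b :=
  calc natAdd a' b' ≤ natAdd a b' := (show StrictMono (fun x => natAdd x b') from
          fun _ _ h => natAdd_lt_left b' h).monotone ha
    _ ≤ natAdd a b := (show StrictMono (natAdd a) from fun _ _ h => natAdd_lt_right a h).monotone hb

/-- This is why ranks are merged by natural sums: the ordinary sum is not strictly monotone on the
left, so a level of an ordinary sum need not fix both summands. -/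
theorem eq_and_eq_of_natAdd_eq {a a' b b' : Ordinal.{0}} (ha : a' ≤ a) (hb : b' ≤ b)
    (h : natAdd a' b' = natAdd a b) : a' = a ∧ b' = b := by
  constructor
  · by_contra hne
    exact absurd h ((natAdd_lt_left b' (lt_of_le_of_ne ha hne)).trans_le
      (natAdd_le_natAdd le_rfl hb)).ne
  · by_contra hne
    exact absurd h ((natAdd_lt_right a' (lt_of_le_of_ne hb hne)).trans_le
      (natAdd_le_natAdd ha le_rfl)).ne

/-- Double induction. Lowering an argument either drops a whole block of length `P`, which outweighs
any natural sum of remainders, or keeps the block and lowers the remainder. -/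
theorem natAdd_mul_add_le {P : Ordinal.{0}}
    (hP : ∀ a < P, ∀ b < P, natAdd a b < P) (a : Ordinal.{0}) :
    ∀ b : Ordinal.{0}, ∀ i j : ℕ, ∀ r < P, ∀ s < P, a = P * i + r → b = P * j + s →
      natAdd a b ≤ P * (i + j : ℕ) + natAdd r s := by
  have key : ∀ (k l : ℕ) (t u : Ordinal.{0}), k < l → t < P → P * k + t < P * l + u := by
    intro k l t u hkl ht
    calc P * k + t < P * k + P := by gcongr
      _ = P * (k + 1 : ℕ) := by push_cast; rw [mul_add_one]
      _ ≤ P * l := by gcongr; exact hkl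
      _ ≤ P * l + u := le_self_add
  have decomp : ∀ (x : Ordinal.{0}) (i : ℕ) (r : Ordinal.{0}), r < P → x < P * i + r →
      ∃ (i' : ℕ) (r' : Ordinal.{0}), r' < P ∧ x = P * i' + r' ∧ (i' < i ∨ i' = i ∧ r' < r) := by
    intro x i r hr hx
    have hP0 : P ≠ 0 := (pos_of_gt hr).ne'
    have hlt : x < P * (i + 1 : ℕ) :=
      hx.trans (by push_cast; rw [mul_add_one]; gcongr)
    have hdiv : x / P < (i + 1 : ℕ) := (Ordinal.lt_mul_iff_div_lt hP0).1 hlt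
    obtain ⟨i', hi'⟩ := Ordinal.lt_omega0.1 (hdiv.trans (Ordinal.natCast_lt_omega0 _))
    refine ⟨i', x % P, Ordinal.mod_lt _ hP0, by rw [← hi', Ordinal.div_add_mod], ?_⟩
    rw [hi'] at hdiv
    have : i' < i + 1 := by exact_mod_cast hdiv
    rcases (Nat.lt_succ_iff.1 this).lt_or_eq with h | h
    · exact Or.inl h
    · refine Or.inr ⟨h, ?_⟩
      rw [← Ordinal.div_add_mod x P, hi', h] at hx
      exact lt_of_add_lt_add_left hx
  induction a using WellFoundedLT.induction with
  | ind a iha =>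
    intro b
    induction b using WellFoundedLT.induction with
    | ind b ihb =>
      intro i j r hr s hs ha hb
      rw [natAdd_le_iff]
      constructor
      · intro x hx
        obtain ⟨i', r', hr', hx', h⟩ := decomp x i r hr (ha ▸ hx)
        refine (iha x hx b i' j r' hr' s hs hx' hb).trans_lt ?_
        rcases h with h | ⟨rfl, h⟩
        · exact key _ _ _ _ (by omega) (hP _ hr' _ hs)
        · gcongr
          exact natAdd_lt_left s h
      · intro y hy
        obtain ⟨j', s', hs', hy', h⟩ := decomp y j s hs (hb ▸ hy)
        refine (ihb y hy i j' r hr s' hs' ha hy').trans_lt ?_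
        rcases h with h | ⟨rfl, h⟩
        · exact key _ _ _ _ (by omega) (hP _ hr _ hs')
        · gcongr
          exact natAdd_lt_right r h

theorem natAdd_lt_opow (μ : Ordinal.{0}) :
    ∀ a < (ω : Ordinal.{0}) ^ μ, ∀ b < (ω : Ordinal.{0}) ^ μ, natAdd a b < ω ^ μ := by
  induction μ using WellFoundedLT.induction with
  | ind μ ih =>
    intro a ha b hb
    rcases eq_or_ne μ 0 with rfl | hμ
    · rw [Ordinal.opow_zero, Order.lt_one_iff] at *
      subst ha hb
      rw [← nonpos_iff_eq_zero, natAdd_le_iff]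
      simp
    · obtain ⟨c, hc, n, hn⟩ := (Ordinal.lt_omega0_opow hμ).1 ha
      obtain ⟨d, hd, m, hm⟩ := (Ordinal.lt_omega0_opow hμ).1 hb
      have hmax : max c d < μ := max_lt hc hd
      set P : Ordinal.{0} := ω ^ max c d with hPdef
      have hP0 : P ≠ 0 := Ordinal.opow_ne_zero _ Ordinal.omega0_ne_zero
      have hn' : a < P * n := hn.trans_le (by
        gcongr
        exact Ordinal.opow_le_opow_right Ordinal.omega0_pos (le_max_left _ _))
      have hm' : b < P * m := hm.trans_le (by
        gcongr
        exact Ordinal.opow_le_opow_right Ordinal.omega0_pos (le_max_right _ _))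
      obtain ⟨i, hi⟩ := Ordinal.lt_omega0.1
        (((Ordinal.lt_mul_iff_div_lt hP0).1 hn').trans (Ordinal.natCast_lt_omega0 _))
      obtain ⟨j, hj⟩ := Ordinal.lt_omega0.1
        (((Ordinal.lt_mul_iff_div_lt hP0).1 hm').trans (Ordinal.natCast_lt_omega0 _))
      refine (natAdd_mul_add_le (ih _ hmax) a b i j (a % P) (Ordinal.mod_lt _ hP0) (b % P)
        (Ordinal.mod_lt _ hP0) (by rw [← hi, Ordinal.div_add_mod])
        (by rw [← hj, Ordinal.div_add_mod])).trans_lt ?_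
      calc P * (i + j : ℕ) + natAdd (a % P) (b % P) < P * (i + j : ℕ) + P := by
            gcongr
            exact ih _ hmax _ (Ordinal.mod_lt _ hP0) _ (Ordinal.mod_lt _ hP0)
        _ = P * (i + j + 1 : ℕ) := by push_cast; rw [mul_add_one]
        _ < ω ^ μ := Ordinal.opow_mul_lt_opow (Ordinal.natCast_lt_omega0 _) hmax

/-! ### Countable ordinals and parity. -/

theorem opow_lt_omega_one {μ : Ordinal.{0}} (h : μ < ω₁) : (ω : Ordinal.{0}) ^ μ < ω₁ :=
  Ordinal.isPrincipal_opow_omega 1 Ordinal.omega0_lt_omega_one h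

theorem isSuccLimit_omega0_opow {μ : Ordinal.{0}} (h : μ ≠ 0) :
    Order.IsSuccLimit ((ω : Ordinal.{0}) ^ μ) :=
  Ordinal.isSuccLimit_opow_left Ordinal.isSuccLimit_omega0 h

theorem countable_Iio_of_lt_omega_one {o : Ordinal.{0}} (h : o < ω₁) : (Iio o).Countable := by
  rw [← Cardinal.le_aleph0_iff_set_countable, Cardinal.mk_Iio_ordinal, Cardinal.lift_le_aleph0]
  rw [← Cardinal.ord_aleph, Cardinal.lt_ord, ← zero_add (1 : Ordinal.{0}),
    ← Cardinal.succ_aleph, Order.lt_succ_iff, Cardinal.aleph_zero] at h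
  exact h

theorem exists_monotone_cofinal {Λ : Ordinal.{0}} (h : Order.IsSuccLimit Λ) (hΛ : Λ < ω₁) :
    ∃ θ : ℕ → Ordinal.{0}, Monotone θ ∧ (∀ n, θ n < Λ) ∧ ∀ ξ < Λ, ∃ n, ξ < θ n := by
  have h0 : 0 < Λ := h.bot_lt
  have hc : Countable (Iio Λ) := (countable_Iio_of_lt_omega_one hΛ).to_subtype
  have hne : Nonempty (Iio Λ) := ⟨⟨0, h0⟩⟩
  obtain ⟨u, hu⟩ := exists_surjective_nat (Iio Λ)
  refine ⟨fun n => Order.succ (partialSups (fun i => (u i).1) n),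
    fun m n hmn => Order.succ_le_succ ((partialSups _).mono hmn), fun n => h.succ_lt ?_, fun ξ hξ => ?_⟩
  · rw [partialSups_eq_sup'_range]
    exact (Finset.sup'_lt_iff _).2 fun i _ => (u i).2
  · obtain ⟨n, hn⟩ := hu ⟨ξ, hξ⟩
    refine ⟨n, Order.lt_succ_of_le ?_⟩
    have := le_partialSups (fun i => (u i).1) n
    simpa only [hn] using this

theorem two_mul_of_isSuccLimit {μ : Ordinal.{0}} (h : Order.IsSuccLimit μ) : 2 * μ = μ :=
  Ordinal.mul_omega0_dvd two_pos (by exact_mod_cast Ordinal.natCast_lt_omega0 2)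
    (Ordinal.isSuccPrelimit_iff_omega0_dvd.1 h.isSuccPrelimit)

/-- Since `2 * μ = μ` for `μ` zero or a limit, `μ + 2n = 2 * (μ + n)`. -/
theorem isEvenOrdinal_iff {ξ : Ordinal.{0}} : IsEvenOrdinal ξ ↔ ξ % 2 = 0 := by
  constructor
  · rintro ⟨μ, n, hμ, rfl⟩
    apply Ordinal.mod_eq_zero_of_dvd
    have h2 : (2 : Ordinal.{0}) * μ = μ := by
      rcases hμ with rfl | hμ
      · simp
      · exact two_mul_of_isSuccLimit hμ
    refine ⟨μ + n, ?_⟩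
    rw [mul_add, h2]
    push_cast
    rfl
  · intro h
    set η := ξ / 2 with hη
    have hξ : ξ = 2 * η := by
      conv_lhs => rw [← Ordinal.div_add_mod ξ 2, h, add_zero]
    obtain ⟨n, hn⟩ := Ordinal.lt_omega0.1 (Ordinal.mod_lt η Ordinal.omega0_ne_zero)
    have h2 : (2 : Ordinal.{0}) * (ω * (η / ω)) = ω * (η / ω) :=
      Ordinal.mul_omega0_dvd two_pos (by exact_mod_cast Ordinal.natCast_lt_omega0 2) ⟨_, rfl⟩
    refine ⟨ω * (η / ω), n, ?_, ?_⟩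
    · rcases eq_or_ne (ω * (η / ω)) 0 with h0 | h0
      · exact Or.inl h0
      · exact Or.inr (Ordinal.isSuccLimit_iff.2
          ⟨h0, Ordinal.isSuccPrelimit_iff_omega0_dvd.2 ⟨_, rfl⟩⟩)
    · rw [hξ]
      conv_lhs => rw [← Ordinal.div_add_mod η ω, mul_add, h2, hn]
      push_cast
      rfl

theorem isEvenOrdinal_add_one_iff {ξ : Ordinal.{0}} : IsEvenOrdinal (ξ + 1) ↔ ¬ IsEvenOrdinal ξ := by
  rw [isEvenOrdinal_iff, isEvenOrdinal_iff]
  have h2 : (2 : Ordinal.{0}) ≠ 0 := two_ne_zero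
  have hlt := Ordinal.mod_lt ξ h2
  have hdm := Ordinal.div_add_mod ξ 2
  have hcases : ξ % 2 = 0 ∨ ξ % 2 = 1 := by
    refine Order.le_one_iff.1 (Order.lt_succ_iff.1 (hlt.trans_eq ?_))
    rw [Order.succ_eq_add_one, one_add_one_eq_two]
  rcases hcases with h | h
  · simp only [h, not_true_eq_false, iff_false]
    rw [← hdm, h, add_zero, Ordinal.mul_add_mod_self, Ordinal.mod_eq_of_lt one_lt_two]
    exact one_ne_zero
  · simp only [h, one_ne_zero, not_false_eq_true, iff_true]
    rw [← hdm, h, add_assoc, one_add_one_eq_two, Ordinal.mul_add_mod_self, Ordinal.mod_self]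

/-! ### Upper semicontinuous ranks and the separation rank. -/

/-- `ρ` is an upper semicontinuous ordinal-valued function such that `P x y` holds
for all `y` close to `x` at the same level as `x`. -/
def UscRank {X : Type*} [TopologicalSpace X] (ρ : X → Ordinal.{0}) (P : X → X → Prop) : Prop :=
  ∀ x, ∀ᶠ y in 𝓝 x, ρ y ≤ ρ x ∧ (ρ y = ρ x → P x y)

section
variable {X : Type*} [TopologicalSpace X] {ρ : X → Ordinal.{0}} {P Q : X → X → Prop}

theorem UscRank.mono (h : UscRank ρ P) (hPQ : ∀ x y, P x y → Q x y) : UscRank ρ Q :=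
  fun x => (h x).mono fun y hy => ⟨hy.1, fun e => hPQ x y (hy.2 e)⟩

theorem UscRank.isClosed_le (h : UscRank ρ P) (η : Ordinal.{0}) : IsClosed {x | η ≤ ρ x} := by
  rw [← isOpen_compl_iff, isOpen_iff_mem_nhds]
  intro x hx
  filter_upwards [h x] with y hy
  exact not_le.2 (hy.1.trans_lt (not_le.1 hx))

theorem UscRank.natAdd {ρ' : X → Ordinal.{0}} (h : UscRank ρ P) (h' : UscRank ρ' Q) :
    UscRank (fun x => natAdd (ρ x) (ρ' x)) (fun x y => P x y ∧ Q x y) := by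
  intro x
  filter_upwards [h x, h' x] with y hy hy'
  refine ⟨natAdd_le_natAdd hy.1 hy'.1, fun e => ?_⟩
  have := eq_and_eq_of_natAdd_eq hy.1 hy'.1 e
  exact ⟨hy.2 this.1, hy'.2 this.2⟩

theorem exists_uscRank_forall_mem_finset {ι : Type*} {μ : Ordinal.{0}} (s : Finset ι)
    (P : ι → X → X → Prop)
    (h : ∀ i ∈ s, ∃ ρ : X → Ordinal.{0}, (∀ x, ρ x < ω ^ μ) ∧ UscRank ρ (P i)) :
    ∃ ρ : X → Ordinal.{0}, (∀ x, ρ x < ω ^ μ) ∧ UscRank ρ (fun x y => ∀ i ∈ s, P i x y) := by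
  classical
  induction s using Finset.induction_on with
  | empty =>
    exact ⟨fun _ => 0, fun _ => Ordinal.opow_pos _ Ordinal.omega0_pos, fun x =>
      Eventually.of_forall fun y => ⟨le_rfl, fun _ i hi => absurd hi (Finset.notMem_empty i)⟩⟩
  | insert i s his ih =>
    obtain ⟨ρ, hρ, hρP⟩ := h i (Finset.mem_insert_self i s)
    obtain ⟨ρ', hρ', hρP'⟩ := ih fun j hj => h j (Finset.mem_insert_of_mem hj)
    refine ⟨fun x => natAdd (ρ x) (ρ' x), fun x => natAdd_lt_opow μ _ (hρ x) _ (hρ' x),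
      (hρP.natAdd hρP').mono fun x y hxy j hj => ?_⟩
    rcases Finset.mem_insert.1 hj with rfl | hj
    · exact hxy.1
    · exact hxy.2 j hj

/-- The level of a point in a transfinite sequence of closed sets. -/
theorem IsClosedSeq.exists_level {len : Ordinal.{0}} {F : Ordinal.{0} → Set X}
    (hF : IsClosedSeq len F) (x : X) : ∃ η < len, x ∈ F η ∧ x ∉ F (η + 1) := by
  have hne : {η | x ∉ F η}.Nonempty := ⟨len, by simp [hF.eq_empty len le_rfl]⟩
  have hmem : x ∉ F (sInf {η | x ∉ F η}) := csInf_mem hne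
  have hmin : ∀ η < sInf {η | x ∉ F η}, x ∈ F η := fun η hη => by
    by_contra h
    exact absurd (csInf_le' (show η ∈ {η | x ∉ F η} from h)) (not_le.2 hη)
  have hle : sInf {η | x ∉ F η} ≤ len := csInf_le' (by simp [hF.eq_empty len le_rfl])
  generalize sInf {η | x ∉ F η} = ζ at *
  -- The first index that loses `x` is a successor: `F 0 = univ` excludes zero, continuity or the
  -- empty total intersection excludes limits.
  rcases Ordinal.zero_or_succ_or_isSuccLimit ζ with rfl | ⟨η, rfl⟩ | hlim
  · simp [hF.zero] at hmem
  · exact ⟨η, (Order.lt_succ η).trans_le hle, hmin _ (Order.lt_succ η), hmem⟩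
  · have hx : x ∈ ⋂ η ∈ Iio ζ, F η := mem_iInter₂.2 hmin
    rcases hle.lt_or_eq with hlt | rfl
    · rw [hF.continuous ζ hlt hlim] at hmem
      exact absurd hx hmem
    · rw [hF.inter_empty hlim] at hx
      exact absurd hx (notMem_empty x)

theorem IsClosedSeq.antitone {len : Ordinal.{0}} {F : Ordinal.{0} → Set X}
    (hF : IsClosedSeq len F) : Antitone F := by
  intro η θ h
  rcases lt_or_ge θ len with hθ | hθ
  · exact hF.decreasing η θ h hθ
  · simp [hF.eq_empty θ hθ]

/-- Take `τ` to be the level and `H` the transfinite difference: membership in `H` is the parity of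
the level. -/
theorem exists_uscRank_of_separatedBy {len : Ordinal.{0}} {F : Ordinal.{0} → Set X} {A B : Set X}
    (hF : IsClosedSeq len F) (hS : SeparatedBy len F A B) :
    ∃ (τ : X → Ordinal.{0}) (H : Set X), (∀ x, τ x < len) ∧ A ⊆ H ∧ H ⊆ Bᶜ ∧
      UscRank τ (fun _ _ => True) ∧ ∀ x y, τ y = τ x → (y ∈ H ↔ x ∈ H) := by
  choose τ hτ hmem hnot using hF.exists_level
  have hH : ∀ x, x ∈ (⋃ η ∈ {η : Ordinal.{0} | η < len ∧ IsEvenOrdinal η}, F η \ F (η + 1)) ↔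
      IsEvenOrdinal (τ x) := by
    intro x
    simp only [mem_iUnion, mem_ofPred_eq, exists_prop, Set.mem_sdiff]
    constructor
    · rintro ⟨η, ⟨-, he⟩, h1, h2⟩
      have hle : τ x ≤ η := by
        by_contra hlt
        exact h2 (hF.antitone (Order.add_one_le_of_lt (not_le.1 hlt)) (hmem x))
      have hge : η ≤ τ x := by
        by_contra hlt
        exact hnot x (hF.antitone (Order.add_one_le_of_lt (not_le.1 hlt)) h1)
      rwa [le_antisymm hle hge]
    · exact fun h => ⟨τ x, ⟨hτ x, h⟩, hmem x, hnot x⟩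
  refine ⟨τ, _, hτ, hS.1, hS.2, fun x => ?_, fun x y e => by rw [hH, hH, e]⟩
  have hcl : IsClosed (F (τ x + 1)) := by
    rcases lt_or_ge (τ x + 1) len with h | h
    · exact hF.isClosed _ h
    · simp [hF.eq_empty _ h]
  filter_upwards [hcl.isOpen_compl.mem_nhds (hnot x)] with y hy
  refine ⟨?_, fun _ => trivial⟩
  by_contra hlt
  exact hy (hF.antitone (Order.add_one_le_of_lt (not_le.1 hlt)) (hmem y))

theorem exists_uscRank_of_sepRankSets_le {A B : Set X} {Λ : Ordinal.{0}} (hΛ : Λ < ω₁)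
    (h : sepRankSets A B ≤ Λ) :
    ∃ (τ : X → Ordinal.{0}) (H : Set X), (∀ x, τ x < Λ) ∧ A ⊆ H ∧ H ⊆ Bᶜ ∧
      UscRank τ (fun _ _ => True) ∧ ∀ x y, τ y = τ x → (y ∈ H ↔ x ∈ H) := by
  have hmem : sepRankSets A B ∈ insert ω₁ {len : Ordinal.{0} | len < ω₁ ∧
      ∃ F : Ordinal.{0} → Set X, IsClosedSeq len F ∧ SeparatedBy len F A B} :=
    csInf_mem (insert_nonempty _ _)
  rcases hmem with hmem | ⟨-, F, hF, hS⟩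
  · exact absurd h (not_le.2 (hmem ▸ hΛ))
  · obtain ⟨τ, H, h1, h2⟩ := exists_uscRank_of_separatedBy hF hS
    exact ⟨τ, H, fun x => (h1 x).trans_le h, h2⟩

theorem sepRankSets_le_sepRank (f : X → ℝ) {p q : ℚ} (hpq : p < q) :
    sepRankSets {x | f x ≤ (p : ℝ)} {x | (q : ℝ) ≤ f x} ≤ sepRank f :=
  Ordinal.le_iSup (fun r : {r : ℚ × ℚ // r.1 < r.2} =>
    sepRankSets {x | f x ≤ (r.1.1 : ℝ)} {x | (r.1.2 : ℝ) ≤ f x}) ⟨(p, q), hpq⟩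

/-- A bounded function of separation rank at most `ω ^ μ` is uniformly approximated by step
functions that are locally constant along an upper semicontinuous rank below `ω ^ μ`. -/
theorem exists_step_approx {f : X → ℝ} {μ : Ordinal.{0}} (hμ : μ < ω₁) (hf : IsBddFun f)
    (hr : sepRank f ≤ ω ^ μ) {ε : ℝ} (hε : 0 < ε) :
    ∃ (s : X → ℝ) (ρ : X → Ordinal.{0}), (range s).Finite ∧ (∀ x, |s x - f x| ≤ ε) ∧
      (∀ x, ρ x < ω ^ μ) ∧ UscRank ρ (fun x y => s y = s x) := by
  classical
  obtain ⟨C, hC⟩ := hf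
  obtain ⟨δ, hδ0, hδε⟩ := exists_rat_btwn hε
  obtain ⟨c, hc⟩ := exists_rat_gt C
  obtain ⟨N, hN⟩ := exists_nat_gt (2 * (c : ℝ) / δ)
  have hδ0' : (0 : ℚ) < δ := by exact_mod_cast hδ0
  have hN' : 2 * (c : ℝ) < N * δ := by rwa [div_lt_iff₀ hδ0] at hN
  -- Consecutive thresholds at spacing `δ`, starting from `-c`; the choice of `N` makes them cover
  -- `[-C, C]`.
  have hH : ∀ i : ℕ, ∃ (τ : X → Ordinal.{0}) (H : Set X), (∀ x, τ x < ω ^ μ) ∧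
      {x | f x ≤ ((-c + i * δ : ℚ) : ℝ)} ⊆ H ∧ H ⊆ {x | ((-c + (i + 1) * δ : ℚ) : ℝ) ≤ f x}ᶜ ∧
      UscRank τ (fun _ _ => True) ∧ ∀ x y, τ y = τ x → (y ∈ H ↔ x ∈ H) := fun i =>
    exists_uscRank_of_sepRankSets_le (opow_lt_omega_one hμ)
      ((sepRankSets_le_sepRank f (by linarith)).trans hr)
  choose τ H hτ hAH hHB hus hτH using hH
  obtain ⟨ρ, hρ, hρP⟩ := exists_uscRank_forall_mem_finset (Finset.range N)
    (fun i x y => y ∈ H i ↔ x ∈ H i) (fun i _ => ⟨τ i, hτ i, fun x =>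
      (hus i x).mono fun y hy => ⟨hy.1, fun e => hτH i x y e⟩⟩)
  -- The number of thresholds passed lies between the floor and the ceiling of `(f x + c) / δ`, so
  -- the step function errs by at most `δ < ε`.
  set S : X → Finset ℕ := fun x => (Finset.range N).filter fun i => x ∉ H i with hS
  refine ⟨fun x => -c + δ * (S x).card, ρ, ?_, fun x => ?_, hρ, hρP.mono fun x y hxy => ?_⟩
  · refine ((Finset.range (N + 1)).finite_toSet.image fun k : ℕ => -(c : ℝ) + δ * k).subset ?_
    rintro _ ⟨x, rfl⟩
    refine ⟨(S x).card, ?_, rfl⟩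
    have := Finset.card_filter_le (Finset.range N) fun i => x ∉ H i
    rw [Finset.card_range] at this
    simpa [Nat.lt_succ_iff] using this
  · have hfx := abs_le.1 (hC x)
    set v : ℝ := (f x + c) / δ with hv
    have hvf : δ * v = f x + c := by rw [hv]; field_simp
    have hv0 : 0 ≤ v := div_nonneg (by linarith) hδ0.le
    have hvN : v < N := by rw [hv, div_lt_iff₀ hδ0]; linarith
    have h1 : Finset.range ⌊v⌋₊ ⊆ S x := by
      intro i hi
      rw [Finset.mem_range] at hi
      have hiv : ((i + 1 : ℕ) : ℝ) ≤ v := (Nat.le_floor_iff hv0).1 hi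
      simp only [hS, Finset.mem_filter, Finset.mem_range]
      constructor
      · have : ((i + 1 : ℕ) : ℝ) < N := hiv.trans_lt hvN
        have : i + 1 < N := by exact_mod_cast this
        omega
      · intro hx
        apply hHB i hx
        have := mul_le_mul_of_nonneg_left hiv hδ0.le
        simp only [mem_ofPred_eq]
        push_cast at this ⊢
        linarith
    have h2 : S x ⊆ Finset.range ⌈v⌉₊ := by
      intro i hi
      simp only [hS, Finset.mem_filter] at hi
      rw [Finset.mem_range, Nat.lt_ceil]
      by_contra hvi
      apply hi.2
      apply hAH i
      have := mul_le_mul_of_nonneg_left (not_lt.1 hvi) hδ0.le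
      simp only [mem_ofPred_eq]
      push_cast
      linarith
    have h1' := Finset.card_le_card h1
    have h2' := Finset.card_le_card h2
    rw [Finset.card_range] at h1' h2'
    have h3 : v < (S x).card + 1 := (Nat.lt_floor_add_one v).trans_le (by
      exact_mod_cast Nat.succ_le_succ h1')
    have h4 : ((S x).card : ℝ) < v + 1 := lt_of_le_of_lt (by exact_mod_cast h2')
      (Nat.ceil_lt_add_one hv0)
    have h5 := mul_lt_mul_of_pos_left h3 hδ0
    have h6 := mul_lt_mul_of_pos_left h4 hδ0
    rw [abs_le]
    constructor <;> nlinarith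
  · have : S y = S x := Finset.filter_congr fun i hi => not_congr (hxy i hi)
    simp only [this]

theorem div_two_and_mod_two_of_isSuccLimit {ξ : Ordinal.{0}} (h : Order.IsSuccLimit ξ) : ξ / 2 = ξ ∧ ξ % 2 = 0 := by
  have h2 := two_mul_of_isSuccLimit h
  refine ⟨?_, Ordinal.mod_eq_zero_of_dvd ⟨ξ, h2.symm⟩⟩
  conv_lhs => rw [← h2]
  exact Ordinal.mul_div_cancel _ two_ne_zero

/-- Each level `η` is split in two: index `2η` carries `{η ≤ ρ}`, and the next index keeps the
higher levels together with the closure of `B` in `{η ≤ ρ}`. A point of `A` at level `η` escapes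
that closure by hypothesis. The length stays `Λ` because `2 * Λ = Λ`. -/
theorem sepRankSets_le_of_uscRank {A B : Set X} {Λ : Ordinal.{0}} (hΛ : Λ < ω₁)
    (hlim : Order.IsSuccLimit Λ) (hρ : ∀ x, ρ x < Λ)
    (h : UscRank ρ (fun x y => x ∈ A → y ∉ B)) : sepRankSets A B ≤ Λ := by
  classical
  set G : Ordinal.{0} → Set X := fun ξ =>
    if ξ % 2 = 0 then {x | ξ / 2 ≤ ρ x}
    else {x | ξ / 2 + 1 ≤ ρ x} ∪ closure ({x | ξ / 2 ≤ ρ x} ∩ B) with hG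
  have hupper : ∀ ξ, G ξ ⊆ {x | ξ / 2 ≤ ρ x} := by
    intro ξ
    simp only [hG]
    split_ifs
    · exact Subset.rfl
    · refine union_subset (fun x hx => (show ξ / 2 ≤ ξ / 2 + 1 from le_self_add).trans hx)
        (closure_minimal inter_subset_left (h.isClosed_le _))
  have hlower : ∀ ξ, {x | ξ / 2 + 1 ≤ ρ x} ⊆ G ξ := by
    intro ξ
    simp only [hG]
    split_ifs
    · exact fun x hx => (show ξ / 2 ≤ ξ / 2 + 1 from le_self_add).trans hx
    · exact subset_union_left
  have hclosed : ∀ ξ, IsClosed (G ξ) := by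
    intro ξ
    simp only [hG]
    split_ifs
    · exact h.isClosed_le _
    · exact (h.isClosed_le _).union isClosed_closure
  have hanti : Antitone G := by
    intro ξ ζ hξζ
    have hdiv : ξ / 2 ≤ ζ / 2 := Ordinal.div_le_left hξζ 2
    rcases hdiv.lt_or_eq with hlt | heq
    · exact (hupper ζ).trans (Subset.trans
        (fun x hx => (Order.add_one_le_of_lt hlt).trans hx) (hlower ξ))
    · by_cases h0 : ξ % 2 = 0
      · refine (hupper ζ).trans ?_
        simp only [hG, if_pos h0, heq]
        exact Subset.rfl
      · have hmod : ξ % 2 ≤ ζ % 2 := by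
          rw [← Ordinal.div_add_mod ξ 2, ← Ordinal.div_add_mod ζ 2, heq] at hξζ
          exact le_of_add_le_add_left hξζ
        have h0' : ζ % 2 ≠ 0 := fun e => h0 (nonpos_iff_eq_zero.1 (hmod.trans_eq e))
        simp only [hG, if_neg h0, if_neg h0', heq]
        exact Subset.rfl
  have hinter : ∀ θ : Ordinal.{0}, Order.IsSuccLimit θ → ∀ x, (∀ η < θ, x ∈ G η) → θ ≤ ρ x := by
    intro θ hθ x hx
    by_contra hlt
    have hs : ρ x + 1 < θ := hθ.add_one_lt (not_le.1 hlt)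
    have h2 : 2 * (ρ x + 1) < θ := by
      rw [← two_mul_of_isSuccLimit hθ]
      gcongr
    have := hupper _ (hx _ h2)
    rw [Ordinal.mul_div_cancel _ two_ne_zero] at this
    exact absurd this (not_le.2 (lt_add_one (ρ x)))
  refine csInf_le' (Or.inr ⟨hΛ, fun ξ => if ξ < Λ then G ξ else ∅, ?_, ?_⟩)
  · refine ⟨fun η hη => ?_, ?_, fun η θ hηθ hθ => ?_, fun θ hθ hl => ?_, fun _ => ?_, fun η hη => ?_⟩
    · simp only [if_pos hη]
      exact hclosed η
    · rw [if_pos (show 0 < Λ from hlim.bot_lt)]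
      simp [hG]
    · simp only [if_pos hθ, if_pos (hηθ.trans_lt hθ)]
      exact hanti hηθ
    · rw [if_pos hθ]
      refine Subset.antisymm (subset_iInter₂ fun η hη => ?_) fun x hx => ?_
      · rw [if_pos (lt_trans hη hθ)]
        exact hanti (le_of_lt hη)
      · have hd := div_two_and_mod_two_of_isSuccLimit hl
        simp only [hG, if_pos hd.2, hd.1]
        refine hinter θ hl x fun η hη => ?_
        have := mem_iInter₂.1 hx η hη
        rwa [if_pos (hη.trans hθ)] at this
    · refine eq_empty_of_forall_notMem fun x hx => ?_
      refine absurd (hinter Λ hlim x fun η hη => ?_) (not_le.2 (hρ x))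
      have := mem_iInter₂.1 hx η hη
      rwa [if_pos hη] at this
    · rw [if_neg (not_lt.2 hη)]
  · have heven : ∀ η : Ordinal.{0}, IsEvenOrdinal η → G η = {x | η / 2 ≤ ρ x} ∧
        G (η + 1) = {x | η / 2 + 1 ≤ ρ x} ∪ closure ({x | η / 2 ≤ ρ x} ∩ B) := by
      intro η he
      have h1 : η % 2 = 0 := isEvenOrdinal_iff.1 he
      have h2 : ¬ (η + 1) % 2 = 0 := fun e =>
        isEvenOrdinal_add_one_iff.1 (isEvenOrdinal_iff.2 e) he
      have h3 : (η + 1) / 2 = η / 2 := by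
        have hη : 2 * (η / 2) = η := by
          conv_rhs => rw [← Ordinal.div_add_mod η 2, h1, add_zero]
        rw [Ordinal.div_eq_iff two_ne_zero, hη]
        refine ⟨le_self_add, ?_⟩
        rw [mul_add_one, hη]
        gcongr
        exact one_lt_two
      simp only [hG, if_pos h1, if_neg h2, h3, and_self]
    constructor
    · intro x hx
      have hlt : 2 * ρ x < Λ := by
        rw [← two_mul_of_isSuccLimit hlim]
        gcongr
        exact hρ x
      have he : IsEvenOrdinal (2 * ρ x) :=
        isEvenOrdinal_iff.2 (Ordinal.mod_eq_zero_of_dvd ⟨_, rfl⟩)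
      have hGe := heven _ he
      rw [Ordinal.mul_div_cancel _ two_ne_zero] at hGe
      refine mem_iUnion₂.2 ⟨2 * ρ x, ⟨hlt, he⟩, ?_⟩
      simp only [if_pos hlt, if_pos (hlim.add_one_lt hlt), hGe.1, hGe.2]
      refine ⟨le_refl (ρ x), ?_⟩
      rintro (h1 | h1)
      · exact absurd h1 (not_le.2 (lt_add_one (ρ x)))
      · obtain ⟨y, hy, hyB⟩ := ((mem_closure_iff_frequently.1 h1).and_eventually (h x)).exists
        exact hyB.2 (le_antisymm hyB.1 hy.1) hx hy.2
    · refine iUnion₂_subset fun η hη x hx hxB => ?_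
      simp only [if_pos hη.1, if_pos (hlim.add_one_lt hη.1), (heven η hη.2).1, (heven η hη.2).2] at hx
      exact hx.2 (Or.inr (subset_closure ⟨hx.1, hxB⟩))

theorem sepRank_le_of_uscRank {f : X → ℝ} {Λ : Ordinal.{0}} (hΛ : Λ < ω₁)
    (hlim : Order.IsSuccLimit Λ)
    (h : ∀ ε : ℝ, 0 < ε → ∃ ρ : X → Ordinal.{0}, (∀ x, ρ x < Λ) ∧
      UscRank ρ (fun x y => |f y - f x| ≤ ε)) : sepRank f ≤ Λ := by
  refine Ordinal.iSup_le fun ⟨⟨p, q⟩, hpq⟩ => ?_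
  have hpq' : (p : ℝ) < q := by exact_mod_cast hpq
  obtain ⟨ρ, hρ, hρP⟩ := h ((q - p) / 2) (by linarith)
  refine sepRankSets_le_of_uscRank hΛ hlim hρ (hρP.mono fun x y hxy hx hy => ?_)
  simp only [mem_ofPred_eq] at hx hy
  have := (abs_le.1 hxy).2
  linarith

end

/-! ### Step functions along a rank are of Baire class 1. -/

theorem isBddFun_of_finite_range {X : Type*} {s : X → ℝ} (hs : (range s).Finite) : IsBddFun s := by
  obtain ⟨C, hC⟩ := (hs.image abs).bddAbove
  exact ⟨C, fun x => hC ⟨s x, mem_range_self x, rfl⟩⟩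

section
variable {X : Type*} [TopologicalSpace X]

theorem IsBaireOne.sum {ι : Type*} (s : Finset ι) {f : ι → X → ℝ}
    (h : ∀ i ∈ s, IsBaireOne (f i)) : IsBaireOne (fun x => ∑ i ∈ s, f i x) := by
  classical
  choose! g hg hlim using h
  exact ⟨fun n x => ∑ i ∈ s, g i n x, fun n => continuous_finsetSum _ fun i hi => hg i hi n,
    fun x => tendsto_finsetSum _ fun i hi => hlim i hi x⟩

theorem IsBaireOne.const_mul {f : X → ℝ} (c : ℝ) (h : IsBaireOne f) :
    IsBaireOne (fun x => c * f x) := by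
  obtain ⟨g, hg, hlim⟩ := h
  exact ⟨fun n x => c * g n x, fun n => continuous_const.mul (hg n),
    fun x => (hlim x).const_mul c⟩

/-- Both `H` and its complement are increasing unions of closed sets; Urysohn functions for the
`n`-th closed sets stabilise at every point. -/
theorem isBaireOne_indicator_of_isGδ [NormalSpace X] {H : Set X} (h1 : IsGδ H) (h2 : IsGδ Hᶜ) :
    IsBaireOne (H.indicator fun _ => (1 : ℝ)) := by
  obtain ⟨u, hu, hHu⟩ := isGδ_iff_eq_iInter_nat.1 h1
  obtain ⟨v, hv, hHv⟩ := isGδ_iff_eq_iInter_nat.1 h2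
  set K : ℕ → Set X := fun n => ⋃ i ∈ Finset.range n, (u i)ᶜ
  set L : ℕ → Set X := fun n => ⋃ i ∈ Finset.range n, (v i)ᶜ
  have hK : ∀ n, IsClosed (K n) := fun n =>
    isClosed_biUnion_finset fun i _ => (hu i).isClosed_compl
  have hL : ∀ n, IsClosed (L n) := fun n =>
    isClosed_biUnion_finset fun i _ => (hv i).isClosed_compl
  have hKH : ∀ n, K n ⊆ Hᶜ := fun n => iUnion₂_subset fun i _ =>
    compl_subset_compl.2 (hHu ▸ iInter_subset u i)
  have hLH : ∀ n, L n ⊆ H := fun n => iUnion₂_subset fun i _ => by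
    rw [← compl_compl H]
    exact compl_subset_compl.2 (hHv ▸ iInter_subset v i)
  have hex : ∀ n, ∃ g : C(X, ℝ), EqOn g 0 (K n) ∧ EqOn g 1 (L n) ∧ ∀ x, g x ∈ Icc (0 : ℝ) 1 :=
    fun n => exists_continuous_zero_one_of_isClosed (hK n) (hL n)
      (disjoint_left.2 fun x hx hx' => hKH n hx (hLH n hx'))
  choose g hg0 hg1 _ using hex
  refine ⟨fun n => g n, fun n => (g n).continuous, fun x => ?_⟩
  by_cases hx : x ∈ H
  · have : x ∉ ⋂ n, v n := by rw [← hHv]; exact fun h => h hx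
    obtain ⟨i, hi⟩ := by simpa only [mem_iInter, not_forall] using this
    rw [indicator_of_mem hx]
    refine tendsto_const_nhds.congr' ?_
    filter_upwards [eventually_gt_atTop i] with n hn
    exact (hg1 n (mem_iUnion₂.2 ⟨i, Finset.mem_range.2 hn, hi⟩)).symm
  · have : x ∉ ⋂ n, u n := by rwa [← hHu]
    obtain ⟨i, hi⟩ := by simpa only [mem_iInter, not_forall] using this
    rw [indicator_of_notMem hx]
    refine tendsto_const_nhds.congr' ?_
    filter_upwards [eventually_gt_atTop i] with n hn
    exact (hg0 n (mem_iUnion₂.2 ⟨i, Finset.mem_range.2 hn, hi⟩)).symm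

/-- A set that is relatively clopen on the levels of a countable upper semicontinuous rank
is a `Gδ` set. -/
theorem UscRank.isGδ [PerfectlyNormalSpace X] {ρ : X → Ordinal.{0}} {H : Set X} {Λ : Ordinal.{0}}
    (hΛ : Λ < ω₁) (hρ : ∀ x, ρ x < Λ) (h : UscRank ρ (fun x y => y ∈ H ↔ x ∈ H)) : IsGδ H := by
  -- The condition at `η = ρ x` alone forces `x ∈ H`: nearby points of `H` of rank at least `ρ x`
  -- have the same rank as `x`.
  have hH : H = ⋂ η ∈ Iio Λ, ({x | η ≤ ρ x}ᶜ ∪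
      ({x | η + 1 ≤ ρ x} ∪ closure ({x | η ≤ ρ x} ∩ H))) := by
    ext x
    simp only [mem_iInter]
    constructor
    · intro hx η _
      by_cases h1 : η ≤ ρ x
      · exact Or.inr (Or.inr (subset_closure ⟨h1, hx⟩))
      · exact Or.inl h1
    · intro hx
      rcases hx (ρ x) (hρ x) with h1 | h1 | h1
      · exact absurd (le_refl (ρ x)) h1
      · exact absurd h1 (not_le.2 (lt_add_one (ρ x)))
      · obtain ⟨y, hy, hyH⟩ := ((mem_closure_iff_frequently.1 h1).and_eventually (h x)).exists
        exact (hyH.2 (le_antisymm hyH.1 hy.1)).1 hy.2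
  rw [hH]
  refine IsGδ.biInter (countable_Iio_of_lt_omega_one hΛ) fun η _ => ?_
  exact (h.isClosed_le η).isOpen_compl.isGδ.union
    (((h.isClosed_le _).union isClosed_closure).isGδ)

theorem UscRank.isBaireOne [PerfectlyNormalSpace X] {ρ : X → Ordinal.{0}} {s : X → ℝ}
    {Λ : Ordinal.{0}} (hΛ : Λ < ω₁) (hρ : ∀ x, ρ x < Λ) (hs : (range s).Finite)
    (h : UscRank ρ (fun x y => s y = s x)) : IsBaireOne s := by
  classical
  have hsum : s = fun x => ∑ v ∈ hs.toFinset, v * (s ⁻¹' {v}).indicator (fun _ => (1 : ℝ)) x := by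
    ext x
    rw [Finset.sum_eq_single (s x)]
    · simp
    · intro v _ hv
      rw [indicator_of_notMem (show x ∉ s ⁻¹' {v} from fun e => hv (mem_singleton_iff.1 e).symm),
        mul_zero]
    · intro hx
      simp at hx
  rw [hsum]
  refine IsBaireOne.sum _ fun v _ => IsBaireOne.const_mul v (isBaireOne_indicator_of_isGδ ?_ ?_)
  · refine UscRank.isGδ hΛ hρ (h.mono fun x y e => ?_)
    simp only [mem_preimage, e]
  · refine UscRank.isGδ hΛ hρ (h.mono fun x y e => ?_)
    simp only [mem_compl_iff, mem_preimage, e]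

/-- Finite-valued functions locally constant along a rank below `ω ^ μ`. -/
theorem mem_bddBaireOne_of_uscRank [PerfectlyNormalSpace X] {ρ : X → Ordinal.{0}} {s : X → ℝ}
    {μ : Ordinal.{0}} (hμ : μ < ω₁) (hμ0 : μ ≠ 0) (hρ : ∀ x, ρ x < ω ^ μ)
    (hs : (range s).Finite) (h : UscRank ρ (fun x y => s y = s x)) : s ∈ BddBaireOne X μ := by
  refine ⟨h.isBaireOne (opow_lt_omega_one hμ) hρ hs, isBddFun_of_finite_range hs,
    sepRank_le_of_uscRank (opow_lt_omega_one hμ) (isSuccLimit_omega0_opow hμ0) fun ε hε =>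
      ⟨ρ, hρ, h.mono fun x y e => ?_⟩⟩
  rw [e, sub_self, abs_zero]
  exact hε.le

theorem exists_uscRank_abs_sub_le {f : X → ℝ} {μ : Ordinal.{0}} (hμ : μ < ω₁) (hf : IsBddFun f)
    (hr : sepRank f ≤ ω ^ μ) {ε : ℝ} (hε : 0 < ε) :
    ∃ ρ : X → Ordinal.{0}, (∀ x, ρ x < ω ^ μ) ∧ UscRank ρ (fun x y => |f y - f x| ≤ ε) := by
  obtain ⟨s, ρ, -, hs, hρ, h⟩ := exists_step_approx hμ hf hr (half_pos hε)
  refine ⟨ρ, hρ, h.mono fun x y e => ?_⟩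
  have h1 := abs_le.1 (hs x)
  have h2 := abs_le.1 (hs y)
  rw [e] at h2
  rw [abs_le]
  constructor <;> linarith

end

/-! ### Derivatives of rank at most `ω` and pseudouniform convergence. -/

section
variable {X : Type*} {D : Set X → Set X} {F : Set X}

theorem iterDeriv_natCast (n : ℕ) : iterDeriv D F n = D^[n] F := by
  induction n with
  | zero => exact Ordinal.limitRecOn_zero ..
  | succ n ih =>
    rw [Function.iterate_succ_apply', ← ih, Nat.cast_succ]
    exact Ordinal.limitRecOn_add_one ..

theorem iterDeriv_omega0 : iterDeriv D F ω = ⋂ n : ℕ, D^[n] F := by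
  have h : iterDeriv D F ω = ⋂ (η : Ordinal.{0}) (_ : η < ω), iterDeriv D F η :=
    Ordinal.limitRecOn_limit _ _ _ _ Ordinal.isSuccLimit_omega0
  rw [h]
  ext x
  simp only [mem_iInter]
  constructor
  · intro hx n
    rw [← iterDeriv_natCast]
    exact hx n (Ordinal.natCast_lt_omega0 n)
  · intro hx η hη
    obtain ⟨n, rfl⟩ := Ordinal.lt_omega0.1 hη
    rw [iterDeriv_natCast]
    exact hx n

theorem derivRank_le_omega0_iff : derivRank D ≤ ω ↔
    (∃ n : ℕ, D^[n] univ = ∅) ∨ ⋂ n : ℕ, D^[n] univ = ∅ := by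
  constructor
  · intro h
    unfold derivRank at h
    split_ifs at h with hex
    · have hmem : iterDeriv D univ (sInf {θ : Ordinal.{0} | iterDeriv D univ θ = ∅}) = ∅ :=
        csInf_mem (s := {θ : Ordinal.{0} | iterDeriv D univ θ = ∅}) hex
      rcases h.lt_or_eq with hlt | heq
      · obtain ⟨n, hn⟩ := Ordinal.lt_omega0.1 hlt
        rw [hn, iterDeriv_natCast] at hmem
        exact Or.inl ⟨n, hmem⟩
      · rw [heq, iterDeriv_omega0] at hmem
        exact Or.inr hmem
    · exact absurd h (not_le.2 Ordinal.omega0_lt_omega_one)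
  · intro h
    obtain ⟨θ, hθ, hle⟩ : ∃ θ : Ordinal.{0}, iterDeriv D univ θ = ∅ ∧ θ ≤ ω := by
      rcases h with ⟨n, hn⟩ | h
      · exact ⟨n, by rw [iterDeriv_natCast, hn], (Ordinal.natCast_lt_omega0 n).le⟩
      · exact ⟨ω, by rw [iterDeriv_omega0, h], le_rfl⟩
    unfold derivRank
    rw [if_pos ⟨θ, hθ⟩]
    exact (csInf_le' (show θ ∈ {θ : Ordinal.{0} | iterDeriv D univ θ = ∅} from hθ)).trans hle

end

section
variable {X : Type*} [TopologicalSpace X]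

/-- Pseudouniform convergence in terms of upper semicontinuous integer-valued ranks. -/
theorem convRank_le_omega0_iff {g : ℕ → X → ℝ} : convRank g ≤ ω ↔
    ∀ ε : ℝ, 0 < ε → ∃ κ : X → ℕ, ∀ x, ∃ N, ∀ᶠ y in 𝓝 x, κ y ≤ κ x ∧
      (κ y = κ x → ∀ m ≥ N, ∀ n ≥ N, |g m y - g n y| ≤ ε) := by
  classical
  constructor
  · intro h ε hε
    have hr : derivRank (seqDeriv g ε) ≤ ω :=
      (Ordinal.le_iSup (fun ε : {ε : ℝ // 0 < ε} => derivRank (seqDeriv g ε.1)) ⟨ε, hε⟩).trans h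
    set D := seqDeriv g ε with hD
    have hex : ∀ x, ∃ n, x ∉ D^[n + 1] univ := by
      intro x
      obtain ⟨n, hn⟩ : ∃ n, x ∉ D^[n] univ := by
        rcases derivRank_le_omega0_iff.1 hr with ⟨n, hn⟩ | h0
        · exact ⟨n, by simp [hn]⟩
        · have : x ∉ ⋂ n : ℕ, D^[n] univ := by simp [h0]
          simpa only [mem_iInter, not_forall] using this
      refine ⟨n, fun hx => hn ?_⟩
      rw [Function.iterate_succ_apply'] at hx
      exact hx.1
    have hmem : ∀ x, x ∈ D^[Nat.find (hex x)] univ := by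
      intro x
      rcases hk : Nat.find (hex x) with _ | k
      · exact mem_univ x
      · by_contra hx
        exact Nat.find_min (hex x) (hk ▸ Nat.lt_succ_self k) hx
    -- `κ x` is the last stage of the derivation that still contains `x`.
    refine ⟨fun x => Nat.find (hex x), fun x => ?_⟩
    have hx := Nat.find_spec (hex x)
    rw [Function.iterate_succ_apply'] at hx
    have hosc : seqOsc g x (D^[Nat.find (hex x)] univ) < ENNReal.ofReal ε :=
      not_le.1 fun hle => hx ⟨hmem x, hle⟩
    simp only [seqOsc, iInf_lt_iff] at hosc
    obtain ⟨U, ⟨hU, hxU⟩, N, hlt⟩ := hosc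
    refine ⟨N, ?_⟩
    filter_upwards [hU.mem_nhds hxU] with y hy
    constructor
    · refine Nat.find_min' (hex y) fun hyD => ?_
      rw [Function.iterate_succ_apply'] at hyD
      refine absurd hyD.2 (not_le.2 (lt_of_le_of_lt ?_ hlt))
      exact iInf₂_le_of_le U ⟨hU, hy⟩ (iInf_le _ N)
    · intro e m hm n hn
      have hyD : y ∈ D^[Nat.find (hex x)] univ := e ▸ hmem y
      have hle : ENNReal.ofReal |g m y - g n y| < ENNReal.ofReal ε := by
        refine lt_of_le_of_lt ?_ hlt
        exact le_iSup_of_le m (le_iSup_of_le n (le_iSup₂_of_le y ⟨hm, hn, hy, hyD⟩ le_rfl))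
      exact ((ENNReal.ofReal_lt_ofReal_iff hε).1 hle).le
  · intro h
    refine Ordinal.iSup_le fun ⟨ε, hε⟩ => derivRank_le_omega0_iff.2 (Or.inr ?_)
    -- Halving makes the oscillation strictly less than `ε`, as leaving the derivative requires.
    obtain ⟨κ, hκ⟩ := h (ε / 2) (half_pos hε)
    have hsub : ∀ n, ∀ x ∈ (seqDeriv g ε)^[n] univ, n ≤ κ x := by
      intro n
      induction n with
      | zero => exact fun _ _ => Nat.zero_le _
      | succ n ih =>
        intro x hx
        rw [Function.iterate_succ_apply'] at hx
        refine Nat.succ_le_of_lt (lt_of_le_of_ne (ih x hx.1) fun e => ?_)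
        obtain ⟨N, hN⟩ := hκ x
        obtain ⟨U, hUN, hU, hxU⟩ := eventually_nhds_iff.1 hN
        refine absurd hx.2 (not_le.2 (lt_of_le_of_lt ?_
          ((ENNReal.ofReal_lt_ofReal_iff hε).2 (half_lt_self hε))))
        refine iInf₂_le_of_le U ⟨hU, hxU⟩ (iInf_le_of_le N ?_)
        refine iSup_le fun m => iSup_le fun k => iSup₂_le fun y hy => ?_
        obtain ⟨hm, hk, hyU, hyD⟩ := hy
        have hy' := hUN y hyU
        exact ENNReal.ofReal_le_ofReal
          (hy'.2 (le_antisymm hy'.1 (e ▸ ih y hyD)) m hm k hk)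
    refine eq_empty_of_forall_notMem fun x hx => ?_
    have := hsub _ x (mem_iInter.1 hx (κ x + 1))
    omega

/-- A pseudouniform limit of functions of rank at most `ω ^ μ` has rank at most `ω ^ (μ + 1)`. -/
theorem sepRank_le_of_pseudouniform {f : X → ℝ} {g : ℕ → X → ℝ} {μ : Ordinal.{0}} (hμ : μ < ω₁)
    (hb : ∀ n, IsBddFun (g n)) (hr : ∀ n, sepRank (g n) ≤ ω ^ μ) (hc : convRank g ≤ ω)
    (hlim : ∀ x, Tendsto (fun n => g n x) atTop (𝓝 (f x))) : sepRank f ≤ ω ^ (μ + 1) := by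
  have hμ1 : μ + 1 < ω₁ := (Cardinal.isSuccLimit_omega 1).add_one_lt hμ
  refine sepRank_le_of_uscRank (opow_lt_omega_one hμ1)
    (isSuccLimit_omega0_opow (add_pos_of_right zero_lt_one μ).ne') fun ε hε => ?_
  have hε3 : 0 < ε / 3 := by linarith
  obtain ⟨κ, hκ⟩ := convRank_le_omega0_iff.1 hc (ε / 3) hε3
  choose ρ hρ hρP using fun n => exists_uscRank_abs_sub_le hμ (hb n) (hr n) hε3
  -- The good index depends on the point. Minimising the rank over all good indices removes the
  -- choice, and goodness of `N` at `x` passes to nearby points of the same `κ`-level, so `r` is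
  -- upper semicontinuous there.
  set valid : X → Set ℕ := fun x =>
    {N | ∀ᶠ y in 𝓝 x, κ y ≤ κ x ∧ (κ y = κ x → |g N y - f y| ≤ ε / 3)} with hvalid
  have hne : ∀ x, (valid x).Nonempty := by
    intro x
    obtain ⟨N, hN⟩ := hκ x
    refine ⟨N, hN.mono fun y hy => ⟨hy.1, fun e => ?_⟩⟩
    refine le_of_tendsto ((tendsto_const_nhds.sub (hlim y)).abs) ?_
    filter_upwards [eventually_ge_atTop N] with n hn
    exact hy.2 e N le_rfl n hn
  set r : X → Ordinal.{0} := fun x => sInf ((fun N => ρ N x) '' valid x) with hrdef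
  have hrmem : ∀ x, ∃ N ∈ valid x, ρ N x = r x := fun x => csInf_mem ((hne x).image _)
  have hrlt : ∀ x, r x < ω ^ μ := by
    intro x
    obtain ⟨N, -, hN⟩ := hrmem x
    exact hN ▸ hρ N x
  refine ⟨fun x => ω ^ μ * κ x + r x, fun x => ?_, fun x => ?_⟩
  · calc ω ^ μ * (κ x : Ordinal.{0}) + r x < ω ^ μ * κ x + ω ^ μ := by gcongr; exact hrlt x
      _ = ω ^ μ * (κ x + 1 : ℕ) := by push_cast; rw [mul_add_one]
      _ < ω ^ (μ + 1) := Ordinal.opow_mul_lt_opow (Ordinal.natCast_lt_omega0 _) (lt_add_one μ)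
  · obtain ⟨N, hN, hNr⟩ := hrmem x
    have hN' : ∀ᶠ y in 𝓝 x, κ y ≤ κ x ∧ (κ y = κ x → |g N y - f y| ≤ ε / 3) := hN
    have hfx := hN'.self_of_nhds.2 rfl
    filter_upwards [hN', hN'.eventually_nhds, hρP N x] with y hy hy2 hyρ
    rcases hy.1.lt_or_eq with hlt | heq
    · have : ω ^ μ * (κ y : Ordinal.{0}) + r y < ω ^ μ * κ x + r x :=
        calc ω ^ μ * (κ y : Ordinal.{0}) + r y < ω ^ μ * κ y + ω ^ μ := by gcongr; exact hrlt y
          _ = ω ^ μ * (κ y + 1 : ℕ) := by push_cast; rw [mul_add_one]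
          _ ≤ ω ^ μ * κ x := by gcongr; exact hlt
          _ ≤ ω ^ μ * κ x + r x := le_self_add
      exact ⟨this.le, fun e => absurd e this.ne⟩
    · have hNy : N ∈ valid y := by
        refine hy2.mono fun z hz => ?_
        rw [heq]
        exact hz
      have hry : r y ≤ ρ N y := csInf_le' ⟨N, hNy, rfl⟩
      rw [heq]
      refine ⟨by gcongr; exact hry.trans (hyρ.1.trans hNr.le), fun e => ?_⟩
      have e' : r y = r x := (add_right_inj _).1 e
      have h1 := abs_le.1 (hyρ.2 (le_antisymm hyρ.1 (by rw [hNr, ← e']; exact hry)))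
      have h2 := abs_le.1 (hy.2 heq)
      have h3 := abs_le.1 hfx
      rw [abs_le]
      constructor <;> linarith

end

/-! ### Truncation to block cores and the approximating sequence. -/

section
variable {X : Type*} [PseudoEMetricSpace X]

/-- The points `x` at distance at least `r` from the set where `ρ` is at least
`β` above the beginning of the block of length `P` containing `ρ x`. -/
def blockCore (ρ : X → Ordinal.{0}) (P β : Ordinal.{0}) (r : ℝ≥0∞) : Set X :=
  {x | r ≤ Metric.infEDist x {y | P * (ρ x / P) + β ≤ ρ y}}

/-- If `y` is in the core, within `r` of `x`, and `ρ y ≤ ρ x`, then both lie in one block, since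
otherwise `x` itself would be a forbidden point too near `y`. So the remainder modulo `P`, which is
below `β` on the core, works as a rank there; it is shifted by one to reserve `0` for the
complement. -/
theorem UscRank.exists_indicator_blockCore {ρ : X → Ordinal.{0}} {t : X → ℝ}
    (h : UscRank ρ (fun x y => t y = t x)) {P β : Ordinal.{0}} (hβ : β ≤ P)
    {r : ℝ≥0∞} (hr : 0 < r) :
    ∃ ρ' : X → Ordinal.{0}, (∀ x, ρ' x ≤ β) ∧
      UscRank ρ' (fun x y => (blockCore ρ P β r).indicator t y =
        (blockCore ρ P β r).indicator t x) := by
  classical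
  set K := blockCore ρ P β r with hK
  have hblock : ∀ x y, edist y x < r → ρ y ≤ ρ x → y ∈ K → ρ y / P = ρ x / P := by
    intro x y hd hle hy
    refine le_antisymm (Ordinal.div_le_left hle P) (not_lt.1 fun hlt => ?_)
    have hx : P * (ρ y / P) + β ≤ ρ x :=
      calc P * (ρ y / P) + β ≤ P * (ρ y / P) + P := by gcongr
        _ = P * (ρ y / P + 1) := by rw [mul_add_one]
        _ ≤ P * (ρ x / P) := by gcongr; exact Order.add_one_le_of_lt hlt
        _ ≤ ρ x := Ordinal.mul_div_le _ _
    exact absurd (le_trans hy (Metric.infEDist_le_edist_of_mem (show x ∈ {z | P * (ρ y / P) + β ≤ ρ z} from hx))) (not_le.2 hd)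
  have hmod : ∀ x ∈ K, ρ x % P < β := by
    intro x hx
    by_contra hlt
    have hmem : P * (ρ x / P) + β ≤ ρ x := by
      conv_rhs => rw [← Ordinal.div_add_mod (ρ x) P]
      gcongr
      exact not_lt.1 hlt
    exact absurd (le_trans hx (Metric.infEDist_zero_of_mem
      (show x ∈ {z | P * (ρ x / P) + β ≤ ρ z} from hmem)).le) (not_le.2 hr)
  refine ⟨fun x => if x ∈ K then ρ x % P + 1 else 0, fun x => ?_, fun x => ?_⟩
  · by_cases hx : x ∈ K
    · simp only [if_pos hx]
      exact Order.add_one_le_of_lt (hmod x hx)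
    · simp only [if_neg hx]
      exact zero_le
  · have hball : ∀ᶠ y in 𝓝 x, edist y x < r := Metric.eball_mem_nhds x hr
    by_cases hx : x ∈ K
    · filter_upwards [hball, h x] with y hyd hy
      rw [if_pos hx]
      by_cases hyK : y ∈ K
      · have hb := hblock x y hyd hy.1 hyK
        rw [if_pos hyK, indicator_of_mem hyK, indicator_of_mem hx]
        have hle : ρ y % P ≤ ρ x % P := by
          have := hy.1
          rw [← Ordinal.div_add_mod (ρ x) P, ← Ordinal.div_add_mod (ρ y) P, hb] at this
          exact le_of_add_le_add_left this
        refine ⟨by gcongr, fun e => hy.2 ?_⟩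
        rw [← Ordinal.div_add_mod (ρ x) P, ← Ordinal.div_add_mod (ρ y) P, hb,
          Order.add_one_inj.1 e]
      · rw [if_neg hyK]
        exact ⟨zero_le, fun e => absurd e (add_pos_of_right zero_lt_one _).ne⟩
    · have hlt : Metric.infEDist x {y | P * (ρ x / P) + β ≤ ρ y} < r := not_le.1 hx
      filter_upwards [hball, h x,
        Metric.continuous_infEDist.continuousAt.eventually_lt_const hlt] with y hyd hy hyS
      have hyK : y ∉ K := by
        intro hyK
        have : r ≤ Metric.infEDist y {z | P * (ρ y / P) + β ≤ ρ z} := hyK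
        rw [hblock x y hyd hy.1 hyK] at this
        exact absurd this (not_le.2 hyS)
      rw [if_neg hx, if_neg hyK, indicator_of_notMem hyK, indicator_of_notMem hx]
      exact ⟨le_rfl, fun _ => rfl⟩

/-- `κ` is the block number, finite because `ω ^ (μ + 1)` consists of `ω` blocks. Once `θ n` exceeds
the remainder of `ρ x`, the forbidden set is closed and misses `x`, hence lies at positive distance,
eventually beyond `1 / (n + 1)` throughout a neighbourhood. -/
theorem UscRank.exists_eventually_mem_blockCore {ρ : X → Ordinal.{0}} {R : X → X → Prop}
    (h : UscRank ρ R) {μ : Ordinal.{0}} (hρ : ∀ x, ρ x < ω ^ (μ + 1)) {θ : ℕ → Ordinal.{0}}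
    (hmono : Monotone θ) (hθ : ∀ ξ < ω ^ μ, ∃ n, ξ < θ n) :
    ∃ κ : X → ℕ, ∀ x, ∃ N, ∀ᶠ y in 𝓝 x, κ y ≤ κ x ∧
      (κ y = κ x → ∀ n ≥ N, y ∈ blockCore ρ (ω ^ μ) (θ n) ((n : ℝ≥0∞) + 1)⁻¹) := by
  set P : Ordinal.{0} := ω ^ μ with hP
  have hP0 : P ≠ 0 := Ordinal.opow_ne_zero _ Ordinal.omega0_ne_zero
  have hκ : ∀ x, ∃ k : ℕ, ρ x / P = k := fun x => by
    refine Ordinal.lt_omega0.1 ((Ordinal.lt_mul_iff_div_lt hP0).1 ?_)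
    rw [hP, ← Ordinal.opow_succ]
    exact hρ x
  choose κ hκ using hκ
  refine ⟨κ, fun x => ?_⟩
  obtain ⟨n₀, hn₀⟩ := hθ (ρ x % P) (Ordinal.mod_lt _ hP0)
  set E : Set X := {y | P * (ρ x / P) + θ n₀ ≤ ρ y} with hE
  have hxE : x ∉ E := by
    intro hx
    have hx' : P * (ρ x / P) + θ n₀ ≤ ρ x := hx
    conv_rhs at hx' => rw [← Ordinal.div_add_mod (ρ x) P]
    exact absurd (le_of_add_le_add_left hx') (not_le.2 hn₀)
  have hpos : 0 < Metric.infEDist x E := by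
    rw [Metric.infEDist_pos_iff_notMem_closure, (h.isClosed_le _).closure_eq]
    exact hxE
  obtain ⟨a, ha0, ha⟩ := exists_between hpos
  obtain ⟨n₁, hn₁⟩ := ENNReal.exists_inv_nat_lt ha0.ne'
  refine ⟨max n₀ n₁, ?_⟩
  filter_upwards [h x, Metric.continuous_infEDist.continuousAt.eventually_const_lt ha] with y hy hya
  constructor
  · have := Ordinal.div_le_left hy.1 P
    rw [hκ, hκ] at this
    exact_mod_cast this
  · intro e n hn
    have hsub : {z | P * (ρ y / P) + θ n ≤ ρ z} ⊆ E := by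
      intro z hz
      have hz' : P * (ρ y / P) + θ n ≤ ρ z := hz
      rw [hκ, e, ← hκ] at hz'
      refine le_trans ?_ hz'
      gcongr
      exact hmono ((le_max_left _ _).trans hn)
    refine le_trans ?_ (Metric.infEDist_anti hsub)
    refine le_trans (le_trans (ENNReal.inv_le_inv.2 ?_) hn₁.le) hya.le
    have : ((n₁ : ℕ) : ℝ≥0∞) ≤ n := by exact_mod_cast (le_max_right _ _).trans hn
    exact this.trans le_self_add

end

theorem finite_range_sum {X ι : Type*} (s : Finset ι) {f : ι → X → ℝ}
    (h : ∀ i ∈ s, (range (f i)).Finite) : (range fun x => ∑ i ∈ s, f i x).Finite := by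
  classical
  induction s using Finset.induction_on with
  | empty => simpa using (finite_singleton (0 : ℝ)).subset range_const_subset
  | insert i s hi ih =>
    refine ((h i (Finset.mem_insert_self i s)).image2 (· + ·)
      (ih fun j hj => h j (Finset.mem_insert_of_mem hj))).subset ?_
    rintro _ ⟨x, rfl⟩
    simp only [Finset.sum_insert hi]
    exact ⟨_, ⟨x, rfl⟩, _, ⟨x, rfl⟩, rfl⟩

theorem abs_sum_indicator_sub_le {X : Type*} {t : ℕ → X → ℝ} {A : ℕ → Set X} {K n : ℕ} {y : X}
    (hKn : K ≤ n) (hA : ∀ k < K, y ∈ A k) (ht : ∀ k ≥ K, |t k y| ≤ 2 * (1 / 2) ^ k) :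
    |∑ k ∈ Finset.range n, (A k).indicator (t k) y - ∑ k ∈ Finset.range K, t k y| ≤
      4 * (1 / 2) ^ K := by
  have hind : ∀ k ≥ K, |(A k).indicator (t k) y| ≤ 2 * (1 / 2) ^ k := fun k hk => by
    by_cases hy : y ∈ A k
    · rw [indicator_of_mem hy]
      exact ht k hk
    · rw [indicator_of_notMem hy, abs_zero]
      positivity
  have hbase : ∑ k ∈ Finset.range K, (A k).indicator (t k) y = ∑ k ∈ Finset.range K, t k y :=
    Finset.sum_congr rfl fun k hk => indicator_of_mem (hA k (Finset.mem_range.1 hk)) _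
  -- The exact partial geometric sum is kept so that the induction closes.
  have key : |∑ k ∈ Finset.range n, (A k).indicator (t k) y - ∑ k ∈ Finset.range K, t k y| ≤
      4 * (1 / 2) ^ K - 4 * (1 / 2) ^ n := by
    induction n, hKn using Nat.le_induction with
    | base => rw [hbase]; simp
    | succ n hn ih =>
      rw [Finset.sum_range_succ, add_sub_right_comm]
      refine (abs_add_le _ _).trans ((add_le_add ih (hind n hn)).trans_eq ?_)
      ring
  refine key.trans (sub_le_self _ (by positivity))

theorem exists_pseudouniform_approx {X : Type*} [PseudoEMetricSpace X] {f : X → ℝ}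
    {μ : Ordinal.{0}} (hμ : μ < ω₁) (hμ0 : μ ≠ 0) (hf : IsBddFun f)
    (hr : sepRank f ≤ ω ^ (μ + 1)) :
    ∃ g : ℕ → X → ℝ, (∀ n, ∃ η < μ, g n ∈ BddBaireOne X (η + 1)) ∧ convRank g ≤ ω ∧
      ∀ x, Tendsto (fun n => g n x) atTop (𝓝 (f x)) := by
  have hμ1 : μ + 1 < ω₁ := (Cardinal.isSuccLimit_omega 1).add_one_lt hμ
  obtain ⟨θ, hmono, hθlt, hθ⟩ :=
    exists_monotone_cofinal (isSuccLimit_omega0_opow hμ0) (opow_lt_omega_one hμ)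
  have hu : ∀ k : ℕ, ∃ (u : X → ℝ) (ρ : X → Ordinal.{0}), (range u).Finite ∧
      (k = 0 → ∀ x, u x = 0) ∧ (k ≠ 0 → ∀ x, |u x - f x| ≤ (1 / 2) ^ k) ∧
      (∀ x, ρ x < ω ^ (μ + 1)) ∧ UscRank ρ (fun x y => u y = u x) := by
    intro k
    -- Starting from `u 0 = 0` makes the partial sums of the differences equal to `u K`; the
    -- geometric bound then holds only for `k ≠ 0`.
    rcases eq_or_ne k 0 with rfl | hk
    · exact ⟨fun _ => 0, fun _ => 0, (finite_singleton (0 : ℝ)).subset range_const_subset,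
        fun _ _ => rfl, fun h => absurd rfl h,
        fun _ => Ordinal.opow_pos _ Ordinal.omega0_pos,
        fun x => Eventually.of_forall fun y => ⟨le_rfl, fun _ => rfl⟩⟩
    · obtain ⟨s, ρ, h1, h2, h3⟩ := exists_step_approx hμ1 hf hr
        (show (0 : ℝ) < (1 / 2) ^ k by positivity)
      exact ⟨s, ρ, h1, fun h => absurd h hk, fun _ => h2, h3⟩
  choose u ρ hufin hu0 huf hρ hρu using hu
  set t : ℕ → X → ℝ := fun k x => u (k + 1) x - u k x with ht
  set σ : ℕ → X → Ordinal.{0} := fun k x => natAdd (ρ (k + 1) x) (ρ k x) with hσ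
  have hσlt : ∀ k x, σ k x < ω ^ (μ + 1) := fun k x =>
    natAdd_lt_opow _ _ (hρ (k + 1) x) _ (hρ k x)
  have hσt : ∀ k, UscRank (σ k) (fun x y => t k y = t k x) := fun k =>
    ((hρu (k + 1)).natAdd (hρu k)).mono fun x y h => by simp only [ht, h.1, h.2]
  have htfin : ∀ k, (range (t k)).Finite := fun k => by
    refine ((hufin (k + 1)).image2 (· - ·) (hufin k)).subset ?_
    rintro _ ⟨x, rfl⟩
    exact ⟨_, ⟨x, rfl⟩, _, ⟨x, rfl⟩, rfl⟩
  have htsum : ∀ K x, ∑ k ∈ Finset.range K, t k x = u K x := fun K x => by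
    rw [Finset.sum_range_sub (fun k => u k x), hu0 0 rfl, sub_zero]
  have htle : ∀ k ≠ 0, ∀ x, |t k x| ≤ 2 * (1 / 2) ^ k := fun k hk x => by
    have h1 := abs_le.1 (huf (k + 1) k.succ_ne_zero x)
    have h2 := abs_le.1 (huf k hk x)
    have h3 : (0 : ℝ) < (1 / 2) ^ k := by positivity
    rw [pow_succ] at h1
    simp only [ht]
    rw [abs_le]
    constructor <;> linarith
  set A : ℕ → ℕ → Set X := fun n k => blockCore (σ k) (ω ^ μ) (θ n) ((n : ℝ≥0∞) + 1)⁻¹ with hA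
  set g : ℕ → X → ℝ := fun n x => ∑ k ∈ Finset.range n, (A n k).indicator (t k) x with hg
  choose κ hκ using fun k => (hσt k).exists_eventually_mem_blockCore (hσlt k) hmono hθ
  have hgu : ∀ K ≠ 0, ∀ n ≥ K, ∀ y, (∀ k < K, y ∈ A n k) →
      |g n y - u K y| ≤ 4 * (1 / 2) ^ K := fun K hK n hn y hy => by
    rw [← htsum]
    exact abs_sum_indicator_sub_le hn hy fun k hk => htle k (by omega) y
  have hsum : ∀ K ≠ 0, ∃ κ' : X → ℕ, ∀ x, ∃ N, ∀ᶠ y in 𝓝 x, κ' y ≤ κ' x ∧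
      (κ' y = κ' x → ∀ n ≥ N, |g n y - u K y| ≤ 4 * (1 / 2) ^ K) := by
    intro K hK
    refine ⟨fun x => ∑ k ∈ Finset.range K, κ k x, fun x => ?_⟩
    choose N hN using fun k => hκ k x
    refine ⟨max K ((Finset.range K).sup N), ?_⟩
    filter_upwards [(Finset.eventually_all (Finset.range K)).2 fun k _ => hN k] with y hy
    refine ⟨Finset.sum_le_sum fun k hk => (hy k hk).1, fun e n hn => ?_⟩
    -- Equal sums of termwise smaller block numbers force every block number to agree, so none of
    -- the first `K` terms is cut off at `y`.
    have he := (Finset.sum_eq_sum_iff_of_le fun k hk => (hy k hk).1).1 e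
    refine hgu K hK n ((le_max_left _ _).trans hn) y fun k hk => ?_
    have hk' := Finset.mem_range.2 hk
    exact (hy k hk').2 (he k hk') n
      ((Finset.le_sup hk').trans ((le_max_right _ _).trans hn))
  have hsmall : ∀ ε : ℝ, 0 < ε → ∃ K ≠ 0, 8 * (1 / 2 : ℝ) ^ K < ε := by
    intro ε hε
    obtain ⟨K, hK⟩ := exists_pow_lt_of_lt_one (show 0 < ε / 8 by linarith)
      (show (1 / 2 : ℝ) < 1 by norm_num)
    refine ⟨K + 1, K.succ_ne_zero, ?_⟩
    have : (0 : ℝ) < (1 / 2) ^ K := by positivity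
    rw [pow_succ]
    linarith
  refine ⟨g, fun n => ?_, convRank_le_omega0_iff.2 fun ε hε => ?_, fun x => ?_⟩
  -- `θ n < ω ^ η * m` for some `η < μ`, whether `μ` is a successor or a limit; the finite sum
  -- defining `g n` then stays below `ω ^ (η + 1)`.
  · obtain ⟨η, hη, m, hm⟩ := (Ordinal.lt_omega0_opow hμ0).1 (hθlt n)
    have hθη : θ n < ω ^ (η + 1) :=
      hm.trans (Ordinal.opow_mul_lt_opow (Ordinal.natCast_lt_omega0 m) (lt_add_one η))
    have hη1 : η + 1 < ω₁ := (Order.add_one_le_of_lt hη).trans_lt hμ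
    obtain ⟨τ, hτ, hτP⟩ := exists_uscRank_forall_mem_finset (μ := η + 1) (Finset.range n)
      (fun k x y => (A n k).indicator (t k) y = (A n k).indicator (t k) x) fun k _ => by
        obtain ⟨ρ', h1, h2⟩ := (hσt k).exists_indicator_blockCore (hθlt n).le
          (show 0 < ((n : ℝ≥0∞) + 1)⁻¹ by simp)
        exact ⟨ρ', fun x => (h1 x).trans_lt hθη, h2⟩
    refine ⟨η, hη, mem_bddBaireOne_of_uscRank hη1 (add_pos_of_right zero_lt_one η).ne' hτ
      (finite_range_sum _ fun k _ => ?_) (hτP.mono fun x y h => Finset.sum_congr rfl h)⟩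
    refine ((htfin k).union (finite_singleton 0)).subset ?_
    rintro _ ⟨x, rfl⟩
    by_cases hx : x ∈ A n k
    · rw [indicator_of_mem hx]
      exact Or.inl ⟨x, rfl⟩
    · rw [indicator_of_notMem hx]
      exact Or.inr rfl
  · obtain ⟨K, hK, hKε⟩ := hsmall ε hε
    obtain ⟨κ', hκ'⟩ := hsum K hK
    refine ⟨κ', fun x => ?_⟩
    obtain ⟨N, hN⟩ := hκ' x
    refine ⟨N, hN.mono fun y hy => ⟨hy.1, fun e m hm n hn => ?_⟩⟩
    have h1 := abs_le.1 (hy.2 e m hm)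
    have h2 := abs_le.1 (hy.2 e n hn)
    rw [abs_le]
    constructor <;> linarith
  · rw [Metric.tendsto_atTop]
    intro ε hε
    obtain ⟨K, hK, hKε⟩ := hsmall ε hε
    obtain ⟨κ', hκ'⟩ := hsum K hK
    obtain ⟨N, hN⟩ := hκ' x
    refine ⟨N, fun n hn => ?_⟩
    have h1 := abs_le.1 (hN.self_of_nhds.2 rfl n hn)
    have h2 := abs_le.1 (huf K hK x)
    have h3 : (0 : ℝ) < (1 / 2) ^ K := by positivity
    rw [Real.dist_eq, abs_lt]
    constructor <;> linarith

theorem phiFamily_eq_bddBaireOne (X : Type*) [TopologicalSpace X] [PolishSpace X]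
    (lam : Ordinal.{0}) (hlam : lam < ω₁) : PhiFamily X lam = BddBaireOne X (lam + 1) := by
  induction lam using WellFoundedLT.induction with
  | ind lam ih =>
    rw [PhiFamily]
    split_ifs with h0
    · rw [h0, zero_add]
    · ext f
      constructor
      · rintro ⟨hB, hb, g, hg, hc, hlim⟩
        have hg' : ∀ n, ∃ η < lam, g n ∈ BddBaireOne X (η + 1) := fun n => by
          obtain ⟨η, hη, hgn⟩ := mem_iUnion₂.1 (hg n)
          exact ⟨η, hη, ih η hη (hη.trans hlam) ▸ hgn⟩
        refine ⟨hB, hb, sepRank_le_of_pseudouniform hlam (fun n => ?_) (fun n => ?_) hc hlim⟩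
        · obtain ⟨η, -, hgn⟩ := hg' n
          exact hgn.2.1
        · obtain ⟨η, hη, hgn⟩ := hg' n
          exact hgn.2.2.trans (Ordinal.opow_le_opow_right Ordinal.omega0_pos
            (Order.add_one_le_of_lt hη))
      · rintro ⟨hB, hb, hr⟩
        let _ := TopologicalSpace.upgradeIsCompletelyMetrizable X
        obtain ⟨g, hg, hc, hlim⟩ := exists_pseudouniform_approx hlam h0 hb hr
        refine ⟨hB, hb, g, fun n => ?_, hc, hlim⟩
        obtain ⟨η, hη, hgn⟩ := hg n
        exact mem_iUnion₂.2 ⟨η, hη, (ih η hη (hη.trans hlam)).symm ▸ hgn⟩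

/-! ### The counterexample at limit exponents. -/

/-- If every value below `ρ x` is attained by `ρ` near `x`, then `ρ` is a lower bound for every
upper semicontinuous rank whose levels decide the parity of `ρ`. -/
theorem le_of_forall_isEvenOrdinal_iff {X : Type*} [TopologicalSpace X] {ρ τ : X → Ordinal.{0}}
    (hdense : ∀ x, ∀ ζ < ρ x, ∃ᶠ y in 𝓝 x, ρ y = ζ) (hτ : UscRank τ (fun _ _ => True))
    (hpar : ∀ x y, τ y = τ x → (IsEvenOrdinal (ρ y) ↔ IsEvenOrdinal (ρ x))) (x : X) :
    ρ x ≤ τ x := by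
  induction hζ : ρ x using WellFoundedLT.induction generalizing x with
  | ind ζ ih =>
    subst hζ
    by_contra hlt
    rw [not_le] at hlt
    -- If `τ x + 1 < ρ x`, a nearby point of `ρ`-value `τ x + 1` breaks semicontinuity of `τ`. If `ρ
    -- x = τ x + 1`, a nearby point of `ρ`-value `τ x` has the same `τ` as `x` but the opposite
    -- parity.
    rcases (Order.add_one_le_of_lt hlt).lt_or_eq with h1 | h1
    · obtain ⟨z, hz, hzτ⟩ := ((hdense x _ h1).and_eventually (hτ x)).exists
      have := ih (τ x + 1) h1 z hz
      exact absurd (this.trans hzτ.1) (not_le.2 (lt_add_one (τ x)))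
    · obtain ⟨y, hy, hyτ⟩ := ((hdense x _ hlt).and_eventually (hτ x)).exists
      have h2 := hpar x y (le_antisymm hyτ.1 (ih (τ x) hlt y hy))
      rw [hy, ← h1, isEvenOrdinal_add_one_iff] at h2
      by_cases he : IsEvenOrdinal (τ x)
      · exact h2.1 he he
      · exact he (h2.2 he)

/-- The sets of natural numbers along which `o` is strictly decreasing. -/
abbrev DecSet (o : ℕ → Ordinal.{0}) : Type :=
  {x : ℕ → Bool // ∀ m n, m < n → x m = true → x n = true → o n < o m}

/-- The empty set is excluded so that the minimum of `o` is attained; this leaves an open part of a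
closed subset of Cantor space. -/
abbrev NonemptyDecSet (o : ℕ → Ordinal.{0}) : Type :=
  {x : DecSet o // ∃ n, x.1 n = true}

namespace NonemptyDecSet

variable {o : ℕ → Ordinal.{0}}

theorem polishSpace (o : ℕ → Ordinal.{0}) : PolishSpace (NonemptyDecSet o) := by
  have hev : ∀ n : ℕ, IsClopen {x : ℕ → Bool | x n = true} := fun n =>
    (isClopen_discrete {true}).preimage (continuous_apply n)
  have h1 : IsClosed {x : ℕ → Bool | ∀ m n, m < n → x m = true → x n = true → o n < o m} := by
    simp only [ofPred_forall, imp_iff_not_or]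
    refine isClosed_iInter fun m => isClosed_iInter fun n => ?_
    refine isClosed_const.union ((hev m).compl.isClosed.union ((hev n).compl.isClosed.union ?_))
    exact isClosed_const
  have : PolishSpace (ℕ → Bool) := { }
  have : PolishSpace (DecSet o) := h1.polishSpace
  refine IsOpen.polishSpace (s := {x : DecSet o | ∃ n, x.1 n = true}) ?_
  rw [ofPred_exists]
  exact isOpen_iUnion fun n => (hev n).isOpen.preimage continuous_subtype_val

/-- The smallest value of `o` on a set. -/
noncomputable def rank (x : NonemptyDecSet o) : Ordinal.{0} :=
  sInf (o '' {n | x.1.1 n = true})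

theorem rank_le (x : NonemptyDecSet o) {n : ℕ} (hn : x.1.1 n = true) : rank x ≤ o n :=
  csInf_le' ⟨n, hn, rfl⟩

theorem exists_rank_eq (x : NonemptyDecSet o) : ∃ n, x.1.1 n = true ∧ o n = rank x :=
  csInf_mem (s := o '' {n | x.1.1 n = true}) (Set.Nonempty.image _ x.2)

theorem eq_false_of_lt (x : NonemptyDecSet o) {m n : ℕ} (hm : x.1.1 m = true)
    (h : o m = rank x) (hmn : m < n) : x.1.1 n = false := by
  by_contra hn
  rw [Bool.not_eq_false] at hn
  exact absurd (rank_le x hn) (not_le.2 (h ▸ x.1.2 m n hmn hm hn))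

/-- The minimum is attained at the last element `m` of `x`. A set agreeing with `x` up to `m`
contains `m`, and can have the same minimum only if nothing follows `m`. -/
theorem uscRank_rank : UscRank (rank (o := o)) (fun x y => y = x) := by
  intro x
  obtain ⟨m, hm, hmr⟩ := exists_rank_eq x
  have hev : ∀ i, ∀ᶠ y : NonemptyDecSet o in 𝓝 x, y.1.1 i = x.1.1 i := fun i =>
    ((continuous_apply i).comp
      (continuous_subtype_val.comp continuous_subtype_val)).continuousAt.eventually
        (show ∀ᶠ b in 𝓝 (x.1.1 i), b = x.1.1 i by simp)
  filter_upwards [(Finset.eventually_all (Finset.range (m + 1))).2 fun i _ => hev i] with y hy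
  have hym : y.1.1 m = true := by rw [hy m (Finset.self_mem_range_succ m), hm]
  refine ⟨hmr ▸ rank_le y hym, fun e => Subtype.ext (Subtype.ext (funext fun i => ?_))⟩
  rcases lt_or_ge m i with hi | hi
  · rw [eq_false_of_lt x hm hmr hi, eq_false_of_lt y hym (hmr.trans e.symm) hi]
  · exact hy i (Finset.mem_range.2 (Nat.lt_succ_of_le hi))

/-- Adjoin to `x` a single index of value `ζ` beyond its last element; as that index tends to
infinity the enlarged sets converge to `x`. -/
theorem frequently_rank_eq (x : NonemptyDecSet o) {ζ : Ordinal.{0}} (hζ : ζ < rank x)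
    (ho : ∀ N, ∃ n > N, o n = ζ) : ∃ᶠ y in 𝓝 x, rank y = ζ := by
  obtain ⟨m, hm, hmr⟩ := exists_rank_eq x
  choose n hn hnζ using fun N => ho (max N m)
  have hmem : ∀ N i j, i < j → Function.update x.1.1 (n N) true i = true →
      Function.update x.1.1 (n N) true j = true → o j < o i := by
    intro N i j hij hi hj
    rcases eq_or_ne j (n N) with rfl | hj'
    · rw [Function.update_of_ne hij.ne] at hi
      rw [hnζ]
      exact hζ.trans_le (rank_le x hi)
    · rw [Function.update_of_ne hj'] at hj
      rcases eq_or_ne i (n N) with rfl | hi'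
      · have := eq_false_of_lt x hm hmr (((le_max_right _ _).trans_lt (hn N)).trans hij)
        rw [hj] at this
        exact absurd this (by decide)
      · rw [Function.update_of_ne hi'] at hi
        exact x.1.2 i j hij hi hj
  set y : ℕ → NonemptyDecSet o := fun N =>
    ⟨⟨Function.update x.1.1 (n N) true, hmem N⟩, n N, Function.update_self ..⟩ with hy
  have hlim : Tendsto y atTop (𝓝 x) := by
    rw [tendsto_subtype_rng, tendsto_subtype_rng, tendsto_pi_nhds]
    intro i
    refine tendsto_const_nhds.congr' ?_
    filter_upwards [eventually_ge_atTop i] with N hN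
    exact (Function.update_of_ne (hN.trans_lt ((le_max_left _ _).trans_lt (hn N))).ne ..).symm
  refine hlim.frequently (Eventually.frequently (Eventually.of_forall fun N => ?_))
  refine le_antisymm (hnζ N ▸ rank_le (y N) (Function.update_self ..)) ?_
  obtain ⟨i, hi, hir⟩ := exists_rank_eq (y N)
  rw [← hir]
  rcases eq_or_ne i (n N) with rfl | hi'
  · exact (hnζ N).ge
  · have hi2 : Function.update x.1.1 (n N) true i = true := hi
    rw [Function.update_of_ne hi'] at hi2
    exact hζ.le.trans (rank_le x hi2)

theorem exists_rank_eq_apply (n : ℕ) : ∃ x : NonemptyDecSet o, rank x = o n := by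
  have h : ∀ i, decide (i = n) = true → i = n := fun i hi => by simpa using hi
  refine ⟨⟨⟨fun i => decide (i = n), fun i j hij hi hj => ?_⟩, n, by simp⟩, ?_⟩
  · exact absurd ((h i hi).trans (h j hj).symm) hij.ne
  · obtain ⟨i, hi, hir⟩ := exists_rank_eq (o := o)
      ⟨⟨fun i => decide (i = n), fun i j hij hi hj =>
        absurd ((h i hi).trans (h j hj).symm) hij.ne⟩, n, by simp⟩
    rw [← hir, h i hi]

end NonemptyDecSet

theorem exists_forall_exists_gt_eq {Λ : Ordinal.{0}} (h0 : 0 < Λ) (hΛ : Λ < ω₁) :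
    ∃ o : ℕ → Ordinal.{0}, (∀ n, o n < Λ) ∧ ∀ ζ < Λ, ∀ N, ∃ n > N, o n = ζ := by
  have hc : Countable (Iio Λ) := (countable_Iio_of_lt_omega_one hΛ).to_subtype
  have hne : Nonempty (Iio Λ) := ⟨⟨0, h0⟩⟩
  obtain ⟨u, hu⟩ := exists_surjective_nat (Iio Λ)
  refine ⟨fun n => (u n.unpair.1).1, fun n => (u _).2, fun ζ hζ N => ?_⟩
  obtain ⟨k, hk⟩ := hu ⟨ζ, hζ⟩
  refine ⟨Nat.pair k (N + 1), (Nat.lt_succ_self N).trans_le (Nat.right_le_pair _ _), ?_⟩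
  simp [hk]

theorem exists_not_uniform_limit {lam : Ordinal.{0}} (hlam : lam < ω₁)
    (hlim : Order.IsSuccLimit lam) :
    ∃ (X : Type) (_ : TopologicalSpace X) (_ : PolishSpace X) (f : X → ℝ),
      f ∈ BddBaireOne X lam ∧
      ¬ ∃ g : ℕ → X → ℝ, (∀ n, g n ∈ ⋃ η ∈ Iio lam, BddBaireOne X η) ∧
        TendstoUniformly g f atTop := by
  classical
  obtain ⟨o, hoΛ, ho⟩ := exists_forall_exists_gt_eq
    (Ordinal.opow_pos lam Ordinal.omega0_pos) (opow_lt_omega_one hlam)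
  have hpol : PolishSpace (NonemptyDecSet o) := NonemptyDecSet.polishSpace o
  have hrank : ∀ x : NonemptyDecSet o, x.rank < ω ^ lam := fun x => by
    obtain ⟨n, -, hn⟩ := x.exists_rank_eq
    exact hn ▸ hoΛ n
  set f : NonemptyDecSet o → ℝ := fun x => if IsEvenOrdinal x.rank then 1 else 0 with hf
  refine ⟨NonemptyDecSet o, inferInstance, hpol, f,
    mem_bddBaireOne_of_uscRank hlam hlim.ne_bot hrank ?_
      (NonemptyDecSet.uscRank_rank.mono fun x y e => by rw [e]), ?_⟩
  · refine (Set.toFinite {(1 : ℝ), 0}).subset ?_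
    rintro _ ⟨x, rfl⟩
    by_cases h : IsEvenOrdinal x.rank <;> simp [hf, h]
  · rintro ⟨g, hg, hgf⟩
    obtain ⟨n, hn⟩ := (Metric.tendstoUniformly_iff.1 hgf (1 / 3) (by norm_num)).exists
    obtain ⟨η, hη, -, -, hr⟩ := mem_iUnion₂.1 (hg n)
    have hη' : η < lam := hη
    obtain ⟨τ, H, hτ, hAH, hHB, hus, hτH⟩ := exists_uscRank_of_sepRankSets_le
      (opow_lt_omega_one (hη'.trans hlam))
      ((sepRankSets_le_sepRank (g n) (show (1 / 3 : ℚ) < 2 / 3 by norm_num)).trans hr)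
    -- A function within `1 / 3` of the parity indicator is below `1 / 3` at odd ranks and above `2
    -- / 3` at even ones, so the separating set is exactly the set of odd ranks.
    have hH : ∀ x, x ∈ H ↔ ¬ IsEvenOrdinal x.rank := by
      intro x
      have hx := hn x
      rw [Real.dist_eq, abs_lt] at hx
      by_cases he : IsEvenOrdinal x.rank
      · simp only [hf, if_pos he] at hx
        refine iff_of_false (fun hxH => hHB hxH ?_) (not_not.2 he)
        simp only [mem_ofPred_eq]
        push_cast
        linarith
      · simp only [hf, if_neg he] at hx
        refine iff_of_true (hAH ?_) he
        simp only [mem_ofPred_eq]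
        push_cast
        linarith
    have hlt : (ω : Ordinal.{0}) ^ η < ω ^ lam :=
      (Ordinal.opow_lt_opow_iff_right Ordinal.one_lt_omega0).2 hη'
    -- A point of rank exactly `ω ^ η` contradicts `τ < ω ^ η`.
    obtain ⟨k, -, hk⟩ := ho _ hlt 0
    obtain ⟨x, hx⟩ := NonemptyDecSet.exists_rank_eq_apply (o := o) k
    have hle := le_of_forall_isEvenOrdinal_iff (ρ := NonemptyDecSet.rank) (τ := τ)
      (fun y ζ hζ => y.frequently_rank_eq hζ (ho ζ (hζ.trans (hrank y)))) hus
      (fun y z e => not_iff_not.1 (by rw [← hH, ← hH]; exact hτH y z e)) x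
    exact absurd (hτ x) (not_lt.2 (by rw [← hk, ← hx]; exact hle))

theorem mainTheorem3 :
    (∀ (X : Type*) [TopologicalSpace X] [PolishSpace X] (lam : Ordinal.{0}), lam < ω₁ →
      PhiFamily X lam = BddBaireOne X (lam + 1)) ∧
    (∀ lam : Ordinal.{0}, lam < ω₁ → Order.IsSuccLimit lam →
      ∃ (X : Type) (_ : TopologicalSpace X) (_ : PolishSpace X) (f : X → ℝ),
        f ∈ BddBaireOne X lam ∧
        ¬ ∃ g : ℕ → X → ℝ, (∀ n, g n ∈ ⋃ η ∈ Iio lam, BddBaireOne X η) ∧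
          TendstoUniformly g f atTop) :=
  ⟨fun X _ _ lam hlam => phiFamily_eq_bddBaireOne X lam hlam,
    fun _ hlam hlim => exists_not_uniform_limit hlam hlim⟩
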